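/- Let $q,d\ge 1$ be integers and let $\mu$ be Lebesgue measure on $[0,1]$. For $v\in[0,1]$ let $\psi_v(u)=(u-v)_+^{q-1}$, $u\in[0,1]$ (with $x_+^0=1\{x\ge 0\}$), and let $\Psi=\{\psi_v: v\in[0,1]\}\subset L_2(\mu)$. Let $\mathcal F=\mathrm{absconv}(\Psi\otimes\cdots\otimes\Psi)\subset L_2(\mu^{d})$ ($d$ factors) be the $L_2(\mu^d)$-closure of the set of finite sums $$\sum_{v\in V_1\times\cdots\times V_d}\beta_v\prod_{k=1}^d\psi_{v_k}(u_k),\qquad V_k\subset[0,1]\ \text{finite},\quad \sum_{v}|\beta_v|\le 1 .$$ Let $D=\prod_{k=1}^d\partial^q/\partial u_k^q$, taken in the sense of distributions on $(0,1)^d$, let $\mathcal N=\{h\in L_2(\mu^d): Dh=0\}$ be its null space, and for $f\in L_2(\mu^d)$ let the $q$-th order Vitali total variation $\|Df\|_1\in[0,\infty]$ be the total variation of $Df$, that is, the supremum of $\int f\,D\varphi\,d\mu^d$ over all smooth $\varphi$ with compact support in $(0,1)^d$ and $|\varphi|\le 1$ (equal to $\int|Df|\,d\mu^d$ for smooth $f$).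 For $T$ in a metric space let $N(\epsilon,T)$ be the minimal number of balls of radius $\epsilon$ covering $T$ and $\mathcal H(\epsilon,T)=\log N(\epsilon,T)$; $L_2$-metrics are used throughout, and $h(\epsilon)\lesssim g(\epsilon)$ means $\limsup_{\epsilon\downarrow 0}h(\epsilon)/g(\epsilon)\leq C<\infty$, where $C$ may depend on $q$ and $d$ only. Then: 1. $N(\epsilon,\Psi)\lesssim 1/\epsilon$ if $q\ge 2$, and $N(\epsilon,\Psi)\lesssim 1/\epsilon^2$ if $q=1$. 2. $\mathcal H(\epsilon,\mathcal F)\lesssim \epsilon^{-1/q}\,\log^{d-1}(1/\epsilon)\,\log^{1/(2q)}(1/\epsilon)$. 3. The orthogonal projection of $\mathcal F$ onto the orthogonal complement $\mathcal N^{\perp}$ in $L_2(\mu^d)$ is exactly the class $\{f\in\mathcal N^\perp:\ \|Df\|_1\le ((q-1)!)^d\}$. 4. The class $\mathcal G=\{f\in\mathcal N^{\perp}:\ \|Df\|_1\le 1\}$ of functions orthogonal to the null space of $D$ with $q$-th order Vitali total variation at most $1$ also satisfies $\mathcal H(\epsilon,\mathcal G)\lesssim \epsilon^{-1/q}\,\log^{d-1}(1/\epsilon)\,\log^{1/(2q)}(1/\epsilon)$.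 -/

import Mathlib

open MeasureTheory Filter Topology Set
open scoped ENNReal NNReal Distributions

noncomputable section

namespace MARS

/-- The truncated power function `u ↦ (u - v)₊ ^ (q - 1)`, with `x₊ ^ 0` the indicator of
`x ≥ 0`. -/
def truncPow (q : ℕ) (v u : ℝ) : ℝ := if v ≤ u then (u - v) ^ (q - 1) else 0

/-- Lebesgue measure on `[0, 1]`. -/
abbrev unitMeasure : Measure ℝ := volume.restrict (Icc 0 1)

/-- The `d`-fold product of Lebesgue measure on `[0, 1]`. -/
abbrev cubeMeasure (d : ℕ) : Measure (Fin d → ℝ) := Measure.pi fun _ : Fin d => unitMeasure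

/-- The Hilbert space `L²` of the unit cube. -/
abbrev L2Cube (d : ℕ) : Type := Lp ℝ 2 (cubeMeasure d)

/-- The class `Ψ` of truncated power functions `ψ_v`, `v ∈ [0, 1]`, in `L²[0, 1]`. -/
def truncPowClass (q : ℕ) : Set (Lp ℝ 2 unitMeasure) :=
  {f | ∃ v ∈ Icc (0 : ℝ) 1, f =ᵐ[unitMeasure] truncPow q v}

/-- The tensor product `u ↦ ∏ k, ψ_{v k} (u k)`. -/
def tensorPow (q : ℕ) {d : ℕ} (v u : Fin d → ℝ) : ℝ := ∏ k, truncPow q (v k) (u k)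

/-- The absolute convex hull `absconv (Ψ ⊗ ⋯ ⊗ Ψ)` (`d` factors): the `L²`-closure of the set of
finite sums `∑ v ∈ V₁ × ⋯ × V_d, β_v • (ψ_{v₁} ⊗ ⋯ ⊗ ψ_{v_d})` with `∑ |β_v| ≤ 1` and finite
sets `V_k ⊆ [0, 1]`. -/
def absconvTensor (q d : ℕ) : Set (L2Cube d) :=
  closure {f | ∃ (V : Fin d → Finset ℝ) (β : (Fin d → ℝ) → ℝ),
    (∀ k, ∀ t ∈ V k, t ∈ Icc (0 : ℝ) 1) ∧
    ∑ v ∈ Fintype.piFinset V, |β v| ≤ 1 ∧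
    f =ᵐ[cubeMeasure d] fun u => ∑ v ∈ Fintype.piFinset V, β v * tensorPow q v u}

/-- The entropy: the logarithm of the covering number (by balls centred in `T`), with value `⊤`
if no finite covering exists. -/
def entropy {X : Type*} [PseudoEMetricSpace X] (ε : ℝ≥0) (T : Set X) : EReal :=
  ENNReal.log (Metric.coveringNumber ε T : ℝ≥0∞)

/-- The open unit cube. -/
def openCube (d : ℕ) : TopologicalSpace.Opens (Fin d → ℝ) :=
  ⟨Set.pi univ fun _ => Ioo 0 1, isOpen_set_pi finite_univ fun _ _ => isOpen_Ioo⟩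

/-- The partial derivative in the `k`-th coordinate. -/
def partialDeriv {d : ℕ} (k : Fin d) (φ : (Fin d → ℝ) → ℝ) : (Fin d → ℝ) → ℝ :=
  fun u => lineDeriv ℝ φ u (Pi.single k 1)

/-- The differential operator `D = ∏ k, ∂^q / ∂u_k^q`. -/
def mixedDeriv (q d : ℕ) (φ : (Fin d → ℝ) → ℝ) : (Fin d → ℝ) → ℝ :=
  (List.finRange d).foldr (fun k g => (partialDeriv k)^[q] g) φ

lemma contDiff_partialDeriv {d : ℕ} (k : Fin d) {φ : (Fin d → ℝ) → ℝ}
    (h : ContDiff ℝ (⊤ : ℕ∞) φ) : ContDiff ℝ (⊤ : ℕ∞) (partialDeriv k φ) := by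
  have e : partialDeriv k φ = fun u => fderiv ℝ φ u (Pi.single k 1) := by
    funext u
    exact ((h.differentiable (by simp)) u).lineDeriv_eq_fderiv
  rw [e]
  exact (h.fderiv_right (m := (⊤ : ℕ∞)) (by simp)).clm_apply contDiff_const

lemma contDiff_mixedDeriv (q d : ℕ) {φ : (Fin d → ℝ) → ℝ} (h : ContDiff ℝ (⊤ : ℕ∞) φ) :
    ContDiff ℝ (⊤ : ℕ∞) (mixedDeriv q d φ) := by
  unfold mixedDeriv
  induction List.finRange d with
  | nil => exact h
  | cons k l ih =>
    rw [List.foldr_cons]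
    have key : ∀ (n : ℕ) (g : (Fin d → ℝ) → ℝ), ContDiff ℝ (⊤ : ℕ∞) g →
        ContDiff ℝ (⊤ : ℕ∞) ((partialDeriv k)^[n] g) := by
      intro n
      induction n with
      | zero => intro g hg; exact hg
      | succ n ihn => intro g hg; exact ihn _ (contDiff_partialDeriv k hg)
    exact key q _ ih

lemma integrable_mul_mixedDeriv (q : ℕ) {d : ℕ} (f : L2Cube d) (φ : 𝓓(openCube d, ℝ)) :
    Integrable (fun u => f u * mixedDeriv q d φ u) (cubeMeasure d) := by
  have hc : Continuous (mixedDeriv q d φ) := (contDiff_mixedDeriv q d φ.contDiff).continuous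
  have hK : IsCompact (Set.pi univ fun _ : Fin d => Icc (0 : ℝ) 1) :=
    isCompact_univ_pi fun _ => isCompact_Icc
  obtain ⟨C, hC⟩ := hK.exists_bound_of_continuousOn hc.continuousOn
  have hr : cubeMeasure d = volume.restrict (Set.pi univ fun _ : Fin d => Icc (0 : ℝ) 1) := by
    rw [volume_pi, Measure.restrict_pi_pi]
  have hf : Integrable (f : (Fin d → ℝ) → ℝ) (cubeMeasure d) :=
    (Lp.memLp f).integrable (by norm_num)
  refine hf.mul_bdd (c := C) hc.aestronglyMeasurable ?_
  rw [hr]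
  exact (ae_restrict_iff' (MeasurableSet.univ_pi fun _ => measurableSet_Icc)).2
    (Eventually.of_forall hC)

/-- The null space of `D` in `L²`: all `f` with `D f = 0` in the sense of distributions on the
open cube. -/
def nullSpace (q d : ℕ) : Submodule ℝ (L2Cube d) where
  carrier := {f | ∀ φ : 𝓓(openCube d, ℝ), ∫ u, f u * mixedDeriv q d φ u ∂(cubeMeasure d) = 0}
  zero_mem' := by
    intro φ
    rw [integral_congr_ae (g := fun _ => (0 : ℝ)), integral_zero]
    filter_upwards [Lp.coeFn_zero ℝ 2 (cubeMeasure d)] with u hu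
    exact mul_eq_zero_of_left hu _
  add_mem' := by
    intro f g hf hg φ
    have e : ∫ u, (f + g : L2Cube d) u * mixedDeriv q d φ u ∂(cubeMeasure d) =
        ∫ u, (f u * mixedDeriv q d φ u + g u * mixedDeriv q d φ u) ∂(cubeMeasure d) := by
      refine integral_congr_ae ?_
      filter_upwards [Lp.coeFn_add f g] with u hu
      rw [hu, Pi.add_apply, add_mul]
    rw [e, integral_add (integrable_mul_mixedDeriv q f φ) (integrable_mul_mixedDeriv q g φ),
      hf φ, hg φ, add_zero]
  smul_mem' := by
    intro c f hf φ
    have e : ∫ u, (c • f : L2Cube d) u * mixedDeriv q d φ u ∂(cubeMeasure d) =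
        ∫ u, c * (f u * mixedDeriv q d φ u) ∂(cubeMeasure d) := by
      refine integral_congr_ae ?_
      filter_upwards [Lp.coeFn_smul c f] with u hu
      rw [hu, Pi.smul_apply, smul_eq_mul, mul_assoc]
    rw [e, integral_const_mul, hf φ, mul_zero]

/-- The `q`-th order Vitali total variation `‖D f‖₁`: the total variation of the distribution
`D f` on the open cube, i.e. the supremum of `∫ f D φ` over the test functions `φ` with `|φ| ≤ 1`.
It is finite exactly if `D f` is a finite signed measure, and equals `∫ |D f|` for smooth `f`. -/
def vitaliVariation (q : ℕ) {d : ℕ} (f : L2Cube d) : ℝ≥0∞ :=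
  ⨆ (φ : 𝓓(openCube d, ℝ)) (_ : ∀ u, |φ u| ≤ 1),
    ENNReal.ofReal (∫ u, f u * mixedDeriv q d φ u ∂(cubeMeasure d))

/-- The functions orthogonal to the null space of `D` with `q`-th order Vitali total variation
at most `r`. -/
def vitaliBall (q d : ℕ) (r : ℝ≥0∞) : Set (L2Cube d) :=
  {f | f ∈ (nullSpace q d)ᗮ ∧ vitaliVariation q f ≤ r}

end MARS

end

/-! Write `W n = 2 ^ n * (n + 1) ^ (d - 1)`. The entropy bound combines two facts about the tensors
of truncated powers. First, all of them lie within squared distance of order `(n + 1) ^ (d - 1) / 2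
^ (n * (2 * q - 1))` from one subspace of dimension `O(W n)`: cut each factor into layers around its
knot, one for each dyadic level, and keep the products of total level at most `n`
(`exists_mem_hyperbolicCross_norm_sub_le`). Second, the tensors have nets of precision `2 ^ (-n *
q)` and size `2 ^ O(n + 1)` (`exists_net_signedTensors`).

A cover of the hull at one scale is refined to the next by treating the two components separately
(`exists_cover_refine`). In the subspace, volume comparison costs `O(W n)` in the logarithm. In its
orthogonal complement the generators are small, and Maurey's averages of `k ~ W n / (n + 1)` net
points again cost `O(W n)`, with error of order `√(n + 1) / 2 ^ (n * q)`. The costs add up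
geometrically. Solving `ε ~ √n / 2 ^ (n * q)` for `2 ^ n` turns the factor `√n`, which the net size
causes, into `log ^ (1 / (2 * q))`.

For the projection, integration by parts shows that `D φ` pairs with the tensor at `v` to `±((q -
1)!) ^ d * φ v`, so every element of the hull has variation at most `((q - 1)!) ^ d`. Conversely,
the hull is compact by the covers, so a point of the ball outside the projected hull could be
strictly separated from it by some `g` in `𝒩ᗮ`. That space is the closure of the functions `D φ`;
replacing `g` by a nearby `D φ` turns the bound of `g` on the hull into a bound of `sup |φ|`, which
the variation of the point contradicts (`inner_le_of_forall_inner_lt`). The entropy of `𝒢` follows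
because projections are contractions. -/

namespace MARS

/-! ### Volume comparison in finite dimension -/

section FiniteCovers

/-- A ball of radius `2 * r` in a finite-dimensional space is covered by `5 ^ dim` balls of
radius `r`. -/
lemma exists_cover_ball_two_mul (E : Type*) [NormedAddCommGroup E] [NormedSpace ℝ E]
    [FiniteDimensional ℝ E] {r : ℝ} (hr : 0 < r) :
    ∃ S : Finset E, S.card ≤ 5 ^ Module.finrank ℝ E ∧
      ∀ x : E, ‖x‖ ≤ 2 * r → ∃ s ∈ S, ‖x - s‖ ≤ r := by
  classical
  -- Volume comparison: disjoint balls of radius `1 / 2` around separated points of the ball of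
  -- radius `2` lie in a ball of radius `5 / 2`.
  have hp : Metric.packingNumber 1 (Metric.closedBall (0 : E) 2) ≤
      ((5 ^ Module.finrank ℝ E : ℕ) : ℕ∞) := by
    unfold Metric.packingNumber
    refine iSup_le fun C => iSup_le fun hC => iSup_le fun hsep => ?_
    by_contra hlt
    push Not at hlt
    -- A separated set may be infinite, so the bound is applied to a subset with one element too
    -- many.
    obtain ⟨t, htC, ht⟩ := Set.exists_subset_encard_eq (Order.add_one_le_of_lt hlt)
    have htf : t.Finite := Set.finite_of_encard_eq_coe (by rw [ht]; norm_cast)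
    have := Besicovitch.card_le_of_separated htf.toFinset
      (fun c hc => by simpa using hC (htC (htf.mem_toFinset.1 hc)))
      (fun c hc d hd hcd => by
        have h1 : ((1 : ℝ≥0) : ℝ≥0∞) < edist c d :=
          hsep (htC (htf.mem_toFinset.1 hc)) (htC (htf.mem_toFinset.1 hd)) hcd
        rw [edist_dist, dist_eq_norm] at h1
        have h2 : ENNReal.ofReal 1 < ENNReal.ofReal ‖c - d‖ := by simpa using h1
        exact ((ENNReal.ofReal_lt_ofReal_iff_of_nonneg zero_le_one).1 h2).le)
    rw [htf.encard_eq_coe_toFinset_card] at ht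
    have h3 : htf.toFinset.card = 5 ^ Module.finrank ℝ E + 1 := by exact_mod_cast ht
    omega
  have hc := (Metric.coveringNumber_le_packingNumber 1 (Metric.closedBall (0 : E) 2)).trans hp
  obtain ⟨C, -, hCf, hCc, hCe⟩ := Metric.exists_set_encard_eq_coveringNumber
    (ne_top_of_le_ne_top (ENat.natCast_ne_top _) hc)
  refine ⟨hCf.toFinset.image (fun s => r • s), Finset.card_image_le.trans ?_, fun x hx => ?_⟩
  · rw [← hCe, hCf.encard_eq_coe_toFinset_card] at hc
    exact_mod_cast hc
  · have hx' : r⁻¹ • x ∈ Metric.closedBall (0 : E) 2 := by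
      rw [mem_closedBall_zero_iff, norm_smul, norm_inv, Real.norm_of_nonneg hr.le]
      rw [inv_mul_le_iff₀ hr]; linarith
    obtain ⟨s, hs, hxs⟩ := hCc hx'
    refine ⟨r • s, Finset.mem_image_of_mem _ (hCf.mem_toFinset.2 hs), ?_⟩
    have h1 : ‖r⁻¹ • x - s‖ ≤ 1 := by
      rw [← dist_eq_norm]
      have h2 : edist (r⁻¹ • x) s ≤ ((1 : ℝ≥0) : ℝ≥0∞) := hxs
      rw [edist_nndist] at h2
      exact_mod_cast h2
    have h2 : x - r • s = r • (r⁻¹ • x - s) := by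
      rw [smul_sub, smul_inv_smul₀ hr.ne']
    rw [h2, norm_smul, Real.norm_of_nonneg hr.le]
    nlinarith

/-- The radius is halved `a` times, and each halving multiplies the number of centres by at most `5
^ dim`. -/
lemma exists_cover_ball_pow (E : Type*) [NormedAddCommGroup E] [NormedSpace ℝ E]
    [FiniteDimensional ℝ E] {r : ℝ} (hr : 0 < r) (a : ℕ) :
    ∃ S : Finset E, S.card ≤ 5 ^ (a * Module.finrank ℝ E) ∧
      ∀ x : E, ‖x‖ ≤ 2 ^ a * r → ∃ s ∈ S, ‖x - s‖ ≤ r := by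
  classical
  induction a with
  | zero => exact ⟨{0}, by simp, fun x hx => ⟨0, by simp, by simpa using hx⟩⟩
  | succ a ih =>
    obtain ⟨S, hS, hSc⟩ := ih
    obtain ⟨S', hS', hSc'⟩ := exists_cover_ball_two_mul E (r := 2 ^ a * r) (by positivity)
    refine ⟨Finset.image₂ (· + ·) S' S, (Finset.card_image₂_le _ _ _).trans ?_, fun x hx => ?_⟩
    · rw [add_mul, one_mul, pow_add, mul_comm]
      exact Nat.mul_le_mul hS hS'
    · obtain ⟨s', hs', h'⟩ := hSc' x (by rw [pow_succ] at hx; linarith)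
      obtain ⟨s, hs, h⟩ := hSc _ h'
      exact ⟨s' + s, Finset.mem_image₂_of_mem hs' hs, by rwa [← sub_sub]⟩

end FiniteCovers

/-! ### Covers of convex hulls in Hilbert space -/

section Hilbert

variable {H : Type*} [NormedAddCommGroup H] [InnerProductSpace ℝ H]

/-- Greedy form of Maurey's lemma: a point of a convex hull is close to averages of few points. -/
lemma exists_norm_nsmul_sub_sum_le {Z : Set H} {r : ℝ} (hZ : ∀ z ∈ Z, ‖z‖ ≤ r) {x : H}
    (hx : x ∈ convexHull ℝ Z) (k : ℕ) :
    ∃ z : Fin k → H, (∀ i, z i ∈ Z) ∧ ‖(k : ℝ) • x - ∑ i, z i‖ ^ 2 ≤ k * (2 * r) ^ 2 := by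
  induction k with
  | zero => exact ⟨Fin.elim0, fun i => i.elim0, by simp⟩
  | succ k ih =>
    obtain ⟨z, hz, hk⟩ := ih
    set S := (k : ℝ) • x - ∑ i, z i with hS
    -- A linear functional at a point of the hull cannot exceed all its values on `Z`. With this `y`
    -- the cross term of `‖S + (x - y)‖ ^ 2` is nonpositive.
    obtain ⟨y, hy, hSy⟩ : ∃ y ∈ Z, inner ℝ S x ≤ inner ℝ S y := by
      by_contra hcon
      push Not at hcon
      have hsub : convexHull ℝ Z ⊆ {w | inner ℝ S w < inner ℝ S x} :=
        convexHull_min hcon (convex_halfSpace_lt (innerSL ℝ S).isLinear _)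
      exact lt_irrefl (inner ℝ S x) (hsub hx)
    have hxr : ‖x‖ ≤ r := by
      have : convexHull ℝ Z ⊆ Metric.closedBall 0 r :=
        convexHull_min (fun w hw => by simpa using hZ w hw) (convex_closedBall _ _)
      simpa using this hx
    refine ⟨Fin.snoc z y, fun i => ?_, ?_⟩
    · refine Fin.lastCases ?_ (fun j => ?_) i
      · simpa using hy
      · simpa using hz j
    · rw [Fin.sum_univ_castSucc]
      simp only [Fin.snoc_castSucc, Fin.snoc_last]
      have e : ((k + 1 : ℕ) : ℝ) • x - (∑ i, z i + y) = S + (x - y) := by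
        rw [hS]; push_cast; rw [add_smul, one_smul]; abel
      have h1 : ‖x - y‖ ≤ 2 * r := (norm_sub_le _ _).trans (by linarith [hZ y hy])
      have h2 : inner ℝ S (x - y) ≤ 0 := by rw [inner_sub_right]; linarith
      rw [e, norm_add_sq_real]
      push_cast
      nlinarith [norm_nonneg (x - y), pow_le_pow_left₀ (norm_nonneg (x - y)) h1 2]

/-- The convex hull of a set with a finite net is covered by few balls. -/
lemma exists_cover_convexHull {Z : Set H} {r η : ℝ} (hr : 0 ≤ r) (hZ : ∀ z ∈ Z, ‖z‖ ≤ r)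
    {Y : Finset H} (hY : ∀ z ∈ Z, ∃ y ∈ Y, ‖z - y‖ ≤ η) {k : ℕ} (hk : 0 < k) :
    ∃ C : Finset H, C.card ≤ Y.card ^ k ∧
      ∀ x ∈ convexHull ℝ Z, ∃ c ∈ C, ‖x - c‖ ≤ 2 * r / √k + η := by
  classical
  refine ⟨(Fintype.piFinset fun _ : Fin k => Y).image fun y => (k : ℝ)⁻¹ • ∑ i, y i,
    Finset.card_image_le.trans (by simp), fun x hx => ?_⟩
  obtain ⟨z, hz, hxz⟩ := exists_norm_nsmul_sub_sum_le hZ hx k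
  choose y hy hzy using fun i => hY (z i) (hz i)
  refine ⟨_, Finset.mem_image_of_mem _ (Fintype.mem_piFinset.2 hy), ?_⟩
  have hk0 : (0 : ℝ) < k := by exact_mod_cast hk
  have e : x - (k : ℝ)⁻¹ • ∑ i, y i =
      (k : ℝ)⁻¹ • ((k : ℝ) • x - ∑ i, z i) + (k : ℝ)⁻¹ • ∑ i, (z i - y i) := by
    rw [Finset.sum_sub_distrib, ← smul_add, sub_add_sub_cancel, smul_sub, inv_smul_smul₀ hk0.ne']
  have h1 : ‖(k : ℝ) • x - ∑ i, z i‖ ≤ √k * (2 * r) := by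
    refine abs_le_of_sq_le_sq' ?_ (by positivity) |>.2
    rwa [mul_pow, Real.sq_sqrt hk0.le]
  have h2 : ‖∑ i, (z i - y i)‖ ≤ k * η := by
    refine (norm_sum_le_of_le _ fun i _ => hzy i).trans ?_
    simp
  rw [e]
  refine (norm_add_le _ _).trans (add_le_add ?_ ?_)
  · rw [norm_smul, norm_inv, Real.norm_of_nonneg hk0.le, inv_mul_le_iff₀ hk0]
    refine h1.trans (le_of_eq ?_)
    have := Real.mul_self_sqrt hk0.le
    have hs : (0 : ℝ) < √k := Real.sqrt_pos.2 hk0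
    field_simp
    nlinarith
  · rw [norm_smul, norm_inv, Real.norm_of_nonneg hk0.le, inv_mul_le_iff₀ hk0]
    exact h2

/-- Refinement of a cover of a convex hull: the part in a finite-dimensional subspace is covered
by volume comparison, the remainder by Maurey's lemma. -/
lemma exists_cover_refine {Z : Set H} (L : Submodule ℝ H) [FiniteDimensional ℝ L]
    {r η ρ : ℝ} (hr : 0 ≤ r) (hρ : 0 < ρ) (hZ : ∀ z ∈ Z, ∃ g ∈ L, ‖z - g‖ ≤ r)
    {Y : Finset H} (hY : ∀ z ∈ Z, ∃ y ∈ Y, ‖z - y‖ ≤ η) {k : ℕ} (hk : 0 < k)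
    (hkr : 2 * r / √k + η ≤ ρ) {C : Finset H} {a : ℕ}
    (hC : ∀ x ∈ convexHull ℝ Z, ∃ c ∈ C, ‖x - c‖ ≤ 2 ^ a * ρ) :
    ∃ C' : Finset H, C'.card ≤ C.card * (5 ^ (a * Module.finrank ℝ L) * Y.card ^ k) ∧
      ∀ x ∈ convexHull ℝ Z, ∃ c ∈ C', ‖x - c‖ ≤ 2 * ρ := by
  classical
  -- `Q` is the projection to `Lᗮ`. It kills `L`, so it maps `Z` into the ball of radius `r`; being
  -- a contraction, it keeps nets.
  let Q : H →L[ℝ] H := ContinuousLinearMap.id ℝ H - L.starProjection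
  have hQ : ∀ x, Q x = x - L.starProjection x := fun x => rfl
  have hQ' : ∀ x, Q x = Lᗮ.starProjection x := fun x => by
    rw [hQ, L.starProjection_orthogonal]; rfl
  have hQn : ∀ x, ‖Q x‖ ≤ ‖x‖ := fun x => by
    rw [hQ']; exact Lᗮ.norm_starProjection_apply_le x
  have hQL : ∀ g ∈ L, Q g = 0 := fun g hg => by
    rw [hQ, Submodule.starProjection_eq_self_iff.2 hg, sub_self]
  obtain ⟨E, hE, hEc⟩ := exists_cover_convexHull (Z := Q '' Z) (Y := Y.image Q) (η := η) hr
    (by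
      rintro _ ⟨z, hz, rfl⟩
      obtain ⟨g, hg, hzg⟩ := hZ z hz
      rw [← sub_zero (Q z), ← hQL g hg, ← map_sub]
      exact (hQn _).trans hzg)
    (by
      rintro _ ⟨z, hz, rfl⟩
      obtain ⟨y, hy, hzy⟩ := hY z hz
      refine ⟨Q y, Finset.mem_image_of_mem _ hy, ?_⟩
      rw [← map_sub]
      exact (hQn _).trans hzy) hk
  obtain ⟨S, hS, hSc⟩ := exists_cover_ball_pow L hρ a
  -- A centre is the `L`-part of an old centre, a correction in `L`, and a Maurey average for the
  -- component in `Lᗮ`.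
  refine ⟨Finset.image₂ (fun c p => L.starProjection c + p)
      C (Finset.image₂ (fun (s : L) e => (s : H) + e) S E), ?_, fun x hx => ?_⟩
  · refine (Finset.card_image₂_le _ _ _).trans (Nat.mul_le_mul_left _ ?_)
    refine (Finset.card_image₂_le _ _ _).trans (Nat.mul_le_mul hS (hE.trans ?_))
    exact Nat.pow_le_pow_left Finset.card_image_le k
  · obtain ⟨c, hc, hxc⟩ := hC x hx
    obtain ⟨s, hs, hxs⟩ := hSc (L.orthogonalProjectionOnto (x - c))
      ((L.norm_orthogonalProjectionOnto_apply_le _).trans hxc)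
    have hQx : Q x ∈ convexHull ℝ (Q '' Z) := by
      have := (Q : H →ₗ[ℝ] H).image_convexHull Z
      rw [show Q '' Z = (Q : H →ₗ[ℝ] H) '' Z from rfl, ← this]
      exact Set.mem_image_of_mem _ hx
    obtain ⟨e, he, hxe⟩ := hEc _ hQx
    refine ⟨_, Finset.mem_image₂_of_mem hc (Finset.mem_image₂_of_mem hs he), ?_⟩
    have h1 : x - (L.starProjection c + ((s : H) + e)) =
        ((L.orthogonalProjectionOnto (x - c) - s : L) : H) + (Q x - e) := by
      rw [hQ]; push_cast
      rw [← Submodule.starProjection_apply, map_sub]; abel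
    rw [h1, two_mul]
    exact (norm_add_le _ _).trans (add_le_add (by exact_mod_cast hxs) (hxe.trans hkr))

/-- `T` is covered by `2 ^ (C * 2 ^ n * (n + 1) ^ D)` balls of radius
`B * √(n + 1) / 2 ^ (n * q)`, for all `n`. -/
def HasDyadicCovers {X : Type*} [PseudoMetricSpace X] (q D : ℕ) (T : Set X) : Prop :=
  ∃ B C : ℕ, 0 < B ∧ ∀ n : ℕ, ∃ S : Finset X, S.card ≤ 2 ^ (C * (2 ^ n * (n + 1) ^ D)) ∧
    ∀ x ∈ T, ∃ c ∈ S, dist x c ≤ B * √(n + 1) / 2 ^ (n * q)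

/-- Covers of a convex hull, from approximations of its generators by finite-dimensional
subspaces and from nets of the generators. -/
lemma hasDyadicCovers_convexHull {Z : Set H} (q D A : ℕ) (hq : 1 ≤ q) (hZ : ∀ z ∈ Z, ‖z‖ ≤ 1)
    (hL : ∀ n : ℕ, ∃ L : Submodule ℝ H, FiniteDimensional ℝ L ∧
      Module.finrank ℝ L ≤ A * (2 ^ n * (n + 1) ^ D) ∧
      ∀ z ∈ Z, ∃ g ∈ L, ‖z - g‖ ^ 2 ≤ A * (n + 1) ^ D / 2 ^ (n * (2 * q - 1)))
    (hY : ∀ n : ℕ, ∃ Y : Finset H, Y.card ≤ 2 ^ (A * (n + 1)) ∧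
      ∀ z ∈ Z, ∃ y ∈ Y, ‖z - y‖ ≤ 1 / 2 ^ (n * q)) :
    HasDyadicCovers q D (convexHull ℝ Z) := by
  -- The radius is `2 * ρ` with `ρ` below. With `K = 3 * (q + 1) * A + 2 * A`, one refinement adds
  -- at most `K * W` to the exponent. As `W` at least doubles at each step, the earlier cost is at
  -- most `K * W` too, hence `2 * K`.
  refine ⟨4 * A + 2, 2 * (3 * (q + 1) * A + 2 * A), by omega, fun n => ?_⟩
  simp only [dist_eq_norm]
  induction n with
  | zero =>
    refine ⟨{0}, by simpa using Nat.one_le_two_pow, fun x hx => ⟨0, by simp, ?_⟩⟩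
    have h1 : convexHull ℝ Z ⊆ Metric.closedBall 0 1 :=
      convexHull_min (fun w hw => by simpa using hZ w hw) (convex_closedBall _ _)
    have h2 : ‖x‖ ≤ 1 := by simpa using h1 hx
    have h3 : (0 : ℝ) ≤ A := by positivity
    simp only [sub_zero, CharP.cast_eq_zero, zero_add, Real.sqrt_one, zero_mul, pow_zero,
      mul_one, div_one]
    push_cast
    linarith
  | succ n ih =>
    obtain ⟨C, hC, hCc⟩ := ih
    obtain ⟨L, hLf, hLd, hLz⟩ := hL (n + 1)
    obtain ⟨Y, hYc, hYn⟩ := hY (n + 1)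
    set N := n + 1 with hN
    set W := 2 ^ N * (N + 1) ^ D with hW
    set k := W / (N + 1) + 1 with hk
    set P : ℝ := 2 ^ (N * q) with hP
    have hP0 : 0 < P := by positivity
    have hs1 : 1 ≤ √((N : ℝ) + 1) := by
      rw [Real.one_le_sqrt]; linarith [(Nat.cast_nonneg N : (0 : ℝ) ≤ N)]
    have hA : (0 : ℝ) ≤ A := by positivity
    set ρ : ℝ := (2 * A + 1) * √(N + 1) / P with hρ
    have hρ0 : 0 < ρ := by positivity
    set r : ℝ := √(A * (N + 1) ^ D / 2 ^ (N * (2 * q - 1))) with hr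
    have hkW : (W : ℝ) ≤ k * (N + 1) := by
      have : W ≤ k * (N + 1) := by
        rw [hk, add_mul, one_mul]
        have h1 := Nat.div_add_mod W (N + 1)
        have h2 := Nat.mod_lt W (show 0 < N + 1 by omega)
        rw [mul_comm (N + 1)] at h1
        omega
      exact_mod_cast this
    have hk0 : 0 < k := Nat.succ_pos _
    have hk0' : (0 : ℝ) < k := by exact_mod_cast hk0
    -- As `k ≥ W / (N + 1)`, the powers of `N + 1` in `r ^ 2` and `W` cancel, and one factor `N + 1`
    -- remains: the source of the extra root of the logarithm.
    have hrk : r / √k ≤ A * √(N + 1) / P := by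
      rw [hr, ← Real.sqrt_div (by positivity)]
      refine Real.sqrt_le_iff.2 ⟨by positivity, ?_⟩
      rw [div_pow, mul_pow, Real.sq_sqrt (by positivity), hP, ← pow_mul,
        show N * q * 2 = N * (2 * q - 1) + N by
          obtain ⟨q', rfl⟩ := Nat.exists_eq_add_of_le' hq
          rw [show 2 * (q' + 1) - 1 = 2 * q' + 1 by omega]; ring, pow_add, div_div,
        div_le_div_iff₀ (by positivity) (by positivity)]
      have hAA : (A : ℝ) ≤ A ^ 2 := by exact_mod_cast Nat.le_self_pow two_ne_zero A
      have h2 : (2 : ℝ) ^ N * (N + 1) ^ D ≤ k * (N + 1) := by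
        refine le_trans (le_of_eq ?_) hkW
        rw [hW]; push_cast; ring
      calc (A : ℝ) * (N + 1) ^ D * (2 ^ (N * (2 * q - 1)) * 2 ^ N)
          = A * 2 ^ (N * (2 * q - 1)) * (2 ^ N * (N + 1) ^ D) := by ring
        _ ≤ A ^ 2 * 2 ^ (N * (2 * q - 1)) * (k * (N + 1)) := by gcongr
        _ = _ := by ring
    obtain ⟨C', hC', hCc'⟩ := exists_cover_refine L (r := r) (η := 1 / P) (ρ := ρ)
      (Real.sqrt_nonneg _) hρ0
      (fun z hz => by
        obtain ⟨g, hg, hzg⟩ := hLz z hz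
        exact ⟨g, hg, Real.le_sqrt_of_sq_le hzg⟩) hYn hk0
      (by
        have : 1 / P ≤ √(N + 1) / P := by gcongr
        rw [mul_div_assoc, hρ]
        calc 2 * (r / √k) + 1 / P ≤ 2 * (A * √(N + 1) / P) + √(N + 1) / P := by gcongr
          _ = _ := by ring)
      -- The main factor of the radius drops by `2 ^ q` between consecutive scales; one more factor
      -- `2` is needed because the old radius has the form `2 * ρ`.
      (a := q + 1) (C := C)
      (fun x hx => by
        obtain ⟨c, hc, hxc⟩ := hCc x hx
        refine ⟨c, hc, hxc.trans ?_⟩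
        have e : (2 : ℝ) ^ (q + 1) * ρ = (2 * (2 * A + 1)) * √(N + 1) / 2 ^ (n * q) := by
          rw [hρ, hP, show N * q = n * q + q by rw [hN]; ring, pow_add, pow_succ]
          field_simp
          ring
        rw [e]
        push_cast
        have h4 : √((n : ℝ) + 1) ≤ √(N + 1) := by
          refine Real.sqrt_le_sqrt ?_
          rw [hN]; push_cast; linarith
        gcongr
        linarith)
    refine ⟨C', hC'.trans ?_, fun x hx => ?_⟩
    · have hkN : (N + 1) * k ≤ 2 * W := by
        have h1 : (N + 1) * (W / (N + 1)) ≤ W := Nat.mul_div_le _ _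
        have h2 : N + 1 ≤ 2 ^ N * (N + 1) ^ D :=
          (Nat.lt_two_pow_self (n := N)).nat_succ_le.trans
            (Nat.le_mul_of_pos_right _ (by positivity))
        rw [hk, mul_add, mul_one]
        omega
      have h5 : (5 : ℕ) ^ ((q + 1) * Module.finrank ℝ L) ≤ 2 ^ (3 * (q + 1) * A * W) := by
        calc 5 ^ ((q + 1) * Module.finrank ℝ L) ≤ (2 ^ 3) ^ ((q + 1) * Module.finrank ℝ L) :=
              Nat.pow_le_pow_left (by norm_num) _
          _ ≤ (2 ^ 3) ^ ((q + 1) * (A * W)) := by gcongr; norm_num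
          _ = _ := by rw [← pow_mul]; ring_nf
      have h6 : Y.card ^ k ≤ 2 ^ (2 * A * W) := by
        calc Y.card ^ k ≤ (2 ^ (A * (N + 1))) ^ k := Nat.pow_le_pow_left hYc _
          _ = 2 ^ (A * ((N + 1) * k)) := by rw [← pow_mul, mul_assoc]
          _ ≤ 2 ^ (A * (2 * W)) := by gcongr; norm_num
          _ = _ := by ring_nf
      calc _ ≤ 2 ^ (2 * (3 * (q + 1) * A + 2 * A) * (2 ^ n * (n + 1) ^ D)) *
            (2 ^ (3 * (q + 1) * A * W) * 2 ^ (2 * A * W)) := by gcongr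
        _ = 2 ^ ((3 * (q + 1) * A + 2 * A) * (2 * (2 ^ n * (n + 1) ^ D)) +
            (3 * (q + 1) * A + 2 * A) * W) := by
            rw [← pow_add, ← pow_add]; ring_nf
        _ ≤ 2 ^ ((3 * (q + 1) * A + 2 * A) * W + (3 * (q + 1) * A + 2 * A) * W) := by
            have : 2 * (2 ^ n * (n + 1) ^ D) ≤ W := by
              rw [hW, hN, pow_succ, mul_comm (2 ^ n) 2, mul_assoc]
              gcongr
              omega
            gcongr
            norm_num
        _ = _ := by ring_nf
    · obtain ⟨c, hc, hxc⟩ := hCc' x hx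
      refine ⟨c, hc, hxc.trans (le_of_eq ?_)⟩
      rw [hρ, hP]; push_cast; ring

end Hilbert

/-! ### From dyadic covers to entropy -/

lemma HasDyadicCovers.closure {X : Type*} [PseudoMetricSpace X] {q D : ℕ} {T : Set X}
    (h : HasDyadicCovers q D T) : HasDyadicCovers q D (closure T) := by
  obtain ⟨B, C, hB, h⟩ := h
  refine ⟨B, C, hB, fun n => ?_⟩
  obtain ⟨S, hS, hT⟩ := h n
  refine ⟨S, hS, fun x hx => ?_⟩
  have hcl : IsClosed (⋃ c ∈ S, Metric.closedBall c (B * √(n + 1) / 2 ^ (n * q))) :=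
    isClosed_biUnion_finset fun c _ => Metric.isClosed_closedBall
  have := hcl.closure_subset_iff.2 (fun y hy => by simpa using hT y hy) hx
  simpa using this

lemma HasDyadicCovers.subset_image {X Y : Type*} [PseudoMetricSpace X] [PseudoMetricSpace Y]
    {q D : ℕ} {T : Set X} (h : HasDyadicCovers q D T) {f : X → Y} (hf : LipschitzWith 1 f)
    {T' : Set Y} (hT' : T' ⊆ f '' T) : HasDyadicCovers q D T' := by
  classical
  obtain ⟨B, C, hB, h⟩ := h
  refine ⟨B, C, hB, fun n => ?_⟩
  obtain ⟨S, hS, hT⟩ := h n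
  refine ⟨S.image f, Finset.card_image_le.trans hS, fun y hy => ?_⟩
  obtain ⟨x, hx, rfl⟩ := hT' hy
  obtain ⟨c, hc, hxc⟩ := hT x hx
  exact ⟨f c, Finset.mem_image_of_mem _ hc, (by simpa using hf.dist_le_mul x c : _ ≤ _).trans hxc⟩

/-- The points of `S` need not lie in `T`, but covering numbers use centres in `T`; moving the
centres doubles the radius. -/
lemma coveringNumber_le_of_finset {X : Type*} [PseudoMetricSpace X] {T : Set X} {S : Finset X}
    {ε : ℝ} (hε : 0 ≤ ε) (hS : ∀ x ∈ T, ∃ c ∈ S, dist x c ≤ ε / 2) :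
    Metric.coveringNumber ε.toNNReal T ≤ (S.card : ℕ∞) := by
  have hc : Metric.IsCover (ε / 2).toNNReal T (S : Set X) := by
    intro x hx
    obtain ⟨c, hc, hxc⟩ := hS x hx
    refine ⟨c, hc, ?_⟩
    change edist x c ≤ _
    rw [edist_dist]
    exact ENNReal.ofReal_le_ofReal hxc
  have h1 := hc.externalCoveringNumber_le_encard
  rw [Set.encard_coe_eq_coe_finsetCard] at h1
  have h2 := Metric.coveringNumber_two_mul_le_externalCoveringNumber (ε / 2).toNNReal T
  have e : 2 * (ε / 2).toNNReal = ε.toNNReal := by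
    rw [← NNReal.coe_inj]
    push_cast
    rw [Real.coe_toNNReal _ hε, Real.coe_toNNReal _ (by positivity)]
    ring
  rw [e] at h2
  exact h2.trans h1

lemma entropy_le_of_finset {X : Type*} [PseudoMetricSpace X] {T : Set X} {S : Finset X}
    {ε : ℝ} (hε : 0 ≤ ε) (hS : ∀ x ∈ T, ∃ c ∈ S, dist x c ≤ ε / 2) {M : ℕ}
    (hM : S.card ≤ 2 ^ M) : entropy ε.toNNReal T ≤ ((M : ℝ) : EReal) := by
  have h1 : (Metric.coveringNumber ε.toNNReal T : ℝ≥0∞) ≤ ENNReal.ofReal (2 ^ M) := by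
    calc (Metric.coveringNumber ε.toNNReal T : ℝ≥0∞) ≤ ((S.card : ℕ∞) : ℝ≥0∞) :=
          ENat.toENNReal_mono (coveringNumber_le_of_finset hε hS)
      _ = ((S.card : ℕ) : ℝ≥0∞) := by simp
      _ ≤ ((2 ^ M : ℕ) : ℝ≥0∞) := by exact_mod_cast hM
      _ = _ := by rw [← ENNReal.ofReal_natCast]; push_cast; rfl
  refine (ENNReal.log_monotone h1).trans ?_
  rw [ENNReal.log_ofReal_of_pos (by positivity), Real.log_pow]
  refine EReal.coe_le_coe_iff.2 ?_
  have : Real.log 2 ≤ 1 := by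
    have := Real.log_two_lt_d9; linarith
  nlinarith [(Nat.cast_nonneg M : (0 : ℝ) ≤ M)]

lemma exists_dyadic_scale_le {q : ℕ} (hq : 1 ≤ q) {B ε : ℝ} (hB : 0 ≤ B) (hε : 0 < ε) :
    ∃ n : ℕ, B * √((n : ℝ) + 1) / 2 ^ (n * q) ≤ ε := by
  have hlim : Tendsto (fun n : ℕ => B * (((n : ℝ) + 1) * (1 / 2) ^ n)) atTop (𝓝 (B * 0)) := by
    refine Tendsto.const_mul _ ?_
    have h1 := tendsto_self_mul_const_pow_of_lt_one (r := 1 / 2) (by norm_num) (by norm_num)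
    have h2 := tendsto_pow_atTop_nhds_zero_of_lt_one (r := (1 : ℝ) / 2) (by norm_num)
      (by norm_num)
    simpa [add_mul] using h1.add h2
  rw [mul_zero] at hlim
  obtain ⟨n, hn⟩ := (hlim.eventually_le_const (hε)).exists
  refine ⟨n, le_trans ?_ hn⟩
  rw [mul_div_assoc]
  have h1 : √((n : ℝ) + 1) ≤ n + 1 := by
    rw [Real.sqrt_le_left (by positivity)]; nlinarith [(Nat.cast_nonneg n : (0 : ℝ) ≤ n)]
  have h2 : (2 : ℝ) ^ n ≤ 2 ^ (n * q) :=
    pow_le_pow_right₀ (by norm_num) (Nat.le_mul_of_pos_right _ hq)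
  rw [one_div, inv_pow, ← div_eq_mul_inv]
  gcongr

/-- This makes the closed hull compact, so that its projection is closed and can be separated from a
point. -/
lemma HasDyadicCovers.totallyBounded {X : Type*} [PseudoMetricSpace X] {q D : ℕ} (hq : 1 ≤ q)
    {T : Set X} (h : HasDyadicCovers q D T) : TotallyBounded T := by
  obtain ⟨B, C, hB, h⟩ := h
  refine Metric.totallyBounded_iff.2 fun ε hε => ?_
  obtain ⟨n, hn⟩ := exists_dyadic_scale_le hq (Nat.cast_nonneg B) (half_pos hε)
  obtain ⟨S, -, hT⟩ := h n
  refine ⟨S, S.finite_toSet, fun x hx => ?_⟩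
  obtain ⟨c, hc, hxc⟩ := hT x hx
  exact mem_biUnion hc (Metric.mem_ball.2 (by linarith))

/-- Dyadic covers give the entropy bound `ε ^ (-1 / q) * log (1 / ε) ^ (D + 1 / (2 * q))`. -/
lemma HasDyadicCovers.entropy_le {X : Type*} [PseudoMetricSpace X] {q D : ℕ} (hq : 1 ≤ q)
    {T : Set X} (h : HasDyadicCovers q D T) :
    ∃ C : ℝ, ∀ᶠ ε : ℝ in 𝓝[>] 0, entropy ε.toNNReal T ≤
      ((C * (ε ^ (-(1 / (q : ℝ))) * Real.log (1 / ε) ^ D *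
        Real.log (1 / ε) ^ (1 / (2 * (q : ℝ)))) : ℝ) : EReal) := by
  obtain ⟨B, C, hB, h⟩ := h
  have hB1 : (1 : ℝ) ≤ B := by exact_mod_cast hB
  have hq0 : (0 : ℝ) < q := by exact_mod_cast hq
  -- The scale used is `n + 1`: the factor `2` comes from `2 ^ (n + 1)`, while `10 ^ D` and `√10`
  -- come from `n + 2 ≤ 10 * L`.
  refine ⟨2 * C * 10 ^ D * (2 * B * √10) ^ (1 / (q : ℝ)), ?_⟩
  filter_upwards [Ioo_mem_nhdsGT
    (show (0 : ℝ) < min (1 / (2 * (B : ℝ))) (Real.exp (-1)) by positivity)]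
    with ε hε
  obtain ⟨hε0, hε1⟩ := hε
  obtain ⟨hεB, hεe⟩ := lt_min_iff.1 hε1
  have hlog : Real.log (1 / ε) = - Real.log ε := by rw [one_div, Real.log_inv]
  have hL1 : 1 ≤ Real.log (1 / ε) := by
    have := (Real.log_lt_iff_lt_exp hε0).2 hεe
    rw [hlog]; linarith
  have hL2 : Real.log (2 * B) ≤ Real.log (1 / ε) := by
    refine Real.log_le_log (by positivity) ?_
    rw [le_one_div (by positivity) hε0]; exact hεB.le
  set L := Real.log (1 / ε) with hL
  set e : ℕ → ℝ := fun n => B * √((n : ℝ) + 1) / 2 ^ (n * q) with he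
  have hex : ∃ n, e n ≤ ε / 2 := exists_dyadic_scale_le hq (by linarith) (by positivity)
  classical
  -- `n + 1` is the first scale of radius at most `ε / 2`. It is not `0`, since the radius there is
  -- `B ≥ 1`. Minimality bounds `2 ^ (n * q)` from above.
  obtain ⟨n, hn⟩ : ∃ n, Nat.find hex = n + 1 := by
    refine Nat.exists_eq_succ_of_ne_zero fun h0 => ?_
    have h1 := Nat.find_spec hex
    rw [h0] at h1
    have h2 : e 0 = B := by simp [he]
    have h3 : ε < 1 / 2 := hεB.trans_le (by
      rw [div_le_div_iff_of_pos_left] <;> linarith)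
    rw [h2] at h1
    linarith
  have hn1 : e (n + 1) ≤ ε / 2 := hn ▸ Nat.find_spec hex
  have hn2 : ε / 2 < e n := not_le.1 (Nat.find_min hex (by omega))
  obtain ⟨S, hS, hT⟩ := h (n + 1)
  refine (entropy_le_of_finset hε0.le (S := S) (fun x hx => ?_) hS).trans ?_
  · obtain ⟨c, hc, hxc⟩ := hT x hx
    exact ⟨c, hc, hxc.trans hn1⟩
  refine EReal.coe_le_coe_iff.2 ?_
  have hP : (2 : ℝ) ^ (n * q) ≤ 2 * B * √(n + 1) / ε := by
    rw [he, lt_div_iff₀ (by positivity)] at hn2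
    rw [le_div_iff₀ hε0]; linarith
  -- After squaring, `n + 1 ≤ 2 ^ n` absorbs the square root and leaves `2 ^ n ≤ (2 * B / ε) ^ 2`,
  -- where `log (2 * B) ≤ L`.
  have hnL : (n : ℝ) ≤ 8 * L := by
    have h1 : ((2 : ℝ) ^ (n * q)) ^ 2 ≤ (2 * B / ε) ^ 2 * 2 ^ n := by
      calc ((2 : ℝ) ^ (n * q)) ^ 2 ≤ (2 * B * √(n + 1) / ε) ^ 2 := by gcongr
        _ = (2 * B / ε) ^ 2 * (n + 1) := by
          rw [mul_div_right_comm, mul_pow, Real.sq_sqrt (by positivity)]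
        _ ≤ _ := by
          gcongr
          exact_mod_cast (Nat.lt_two_pow_self (n := n)).nat_succ_le
    have h2 : (2 : ℝ) ^ n ≤ (2 * B / ε) ^ 2 := by
      have h3 : (2 : ℝ) ^ n * 2 ^ n ≤ ((2 : ℝ) ^ (n * q)) ^ 2 := by
        rw [← pow_mul, ← pow_add]
        refine pow_le_pow_right₀ (by norm_num) ?_
        nlinarith [Nat.le_mul_of_pos_right n hq]
      exact le_of_mul_le_mul_right (h3.trans h1) (by positivity)
    have h4 := Real.log_le_log (by positivity) h2
    rw [Real.log_pow, Real.log_pow, div_eq_mul_one_div,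
      Real.log_mul (by positivity) (by positivity)] at h4
    push_cast at h4
    have := Real.log_two_gt_d9
    nlinarith [(Nat.cast_nonneg n : (0 : ℝ) ≤ n)]
  have h2n : (2 : ℝ) ^ n ≤
      (2 * B * √10) ^ (1 / (q : ℝ)) * (L ^ (1 / (2 * (q : ℝ))) * ε ^ (-(1 / (q : ℝ)))) := by
    have h1 : (2 : ℝ) ^ n = ((2 : ℝ) ^ (n * q)) ^ (1 / (q : ℝ)) := by
      rw [pow_mul, one_div, Real.pow_rpow_inv_natCast (by positivity) (by omega)]
    have h2 : √((n : ℝ) + 1) ≤ √10 * √L := by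
      rw [← Real.sqrt_mul (by norm_num)]
      exact Real.sqrt_le_sqrt (by linarith)
    have h3 : (2 : ℝ) ^ (n * q) ≤ (2 * B * √10) * (√L * ε⁻¹) := by
      refine hP.trans ?_
      rw [div_eq_mul_inv]
      calc 2 * B * √((n : ℝ) + 1) * ε⁻¹ ≤ 2 * B * (√10 * √L) * ε⁻¹ := by gcongr
        _ = _ := by ring
    rw [h1]
    refine (Real.rpow_le_rpow (by positivity) h3 (by positivity)).trans (le_of_eq ?_)
    rw [Real.mul_rpow (x := 2 * B * √10) (by positivity) (by positivity),
      Real.mul_rpow (x := √L) (by positivity) (by positivity), Real.sqrt_eq_rpow L,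
      ← Real.rpow_mul (by positivity), Real.inv_rpow hε0.le, ← Real.rpow_neg hε0.le]
    congr 3
    field_simp
  have hn2' : (n : ℝ) + 1 + 1 ≤ 10 * L := by linarith
  push_cast
  calc (C : ℝ) * (2 ^ (n + 1) * ((n : ℝ) + 1 + 1) ^ D)
      ≤ C * (2 * ((2 * B * √10) ^ (1 / (q : ℝ)) *
          (L ^ (1 / (2 * (q : ℝ))) * ε ^ (-(1 / (q : ℝ))))) * (10 * L) ^ D) := by
        rw [pow_succ, mul_comm ((2 : ℝ) ^ n)]
        gcongr
    _ = _ := by rw [mul_pow]; ring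

/-! ### Tensors of truncated powers and their absolutely convex hull -/

section TruncPow

lemma measurable_truncPow (q : ℕ) (v : ℝ) : Measurable (truncPow q v) := by
  unfold truncPow
  exact Measurable.ite measurableSet_Ici (by fun_prop) measurable_const

lemma truncPow_nonneg (q : ℕ) (v u : ℝ) : 0 ≤ truncPow q v u := by
  unfold truncPow
  split_ifs with h
  · exact pow_nonneg (sub_nonneg.2 h) _
  · exact le_rfl

lemma abs_truncPow_le_one (q : ℕ) {v u : ℝ} (hv : v ∈ Icc (0 : ℝ) 1) (hu : u ∈ Icc (0 : ℝ) 1) :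
    |truncPow q v u| ≤ 1 := by
  rw [abs_of_nonneg (truncPow_nonneg q v u)]
  unfold truncPow
  split_ifs with h
  · exact pow_le_one₀ (sub_nonneg.2 h) (by linarith [hv.1, hu.2])
  · exact zero_le_one

lemma abs_truncPow_le (q : ℕ) (v : ℝ) {u : ℝ} (hu : u ∈ Icc (0 : ℝ) 1) :
    |truncPow q v u| ≤ (1 + |v|) ^ (q - 1) := by
  rw [abs_of_nonneg (truncPow_nonneg q v u)]
  unfold truncPow
  split_ifs with h
  · exact pow_le_pow_left₀ (sub_nonneg.2 h) (by linarith [neg_abs_le v, hu.2]) _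
  · positivity

/-- The endpoint `1` is discarded so that `⌊2 ^ j * u⌋₊ < 2 ^ j`: the dyadic intervals are
half-open. -/
lemma ae_unitMeasure_mem_Ico : ∀ᵐ u ∂unitMeasure, u ∈ Ico (0 : ℝ) 1 := by
  rw [unitMeasure, ← restrict_Ico_eq_restrict_Icc]
  exact ae_restrict_mem measurableSet_Ico

lemma ae_cubeMeasure_mem_Ico (d : ℕ) : ∀ᵐ u ∂cubeMeasure d, ∀ k, u k ∈ Ico (0 : ℝ) 1 :=
  ae_all_iff.2 fun k =>
    (Measure.quasiMeasurePreserving_eval (fun _ : Fin d => unitMeasure) k).ae ae_unitMeasure_mem_Ico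

instance : IsProbabilityMeasure unitMeasure := ⟨by simp [unitMeasure]⟩

lemma norm_sq_eq_integral {α : Type*} [MeasurableSpace α] {μ : Measure α} (f : Lp ℝ 2 μ)
    {g : α → ℝ} (h : f =ᵐ[μ] g) : ‖f‖ ^ 2 = ∫ u, g u ^ 2 ∂μ := by
  rw [← real_inner_self_eq_norm_sq, L2.inner_def]
  refine integral_congr_ae ?_
  filter_upwards [h] with u hu
  rw [real_inner_self_eq_norm_sq, hu, Real.norm_eq_abs, sq_abs]

/-- Tensors of bounded measurable functions are square integrable on the cube. -/
lemma memLp_tensor {d : ℕ} {f : Fin d → ℝ → ℝ} (hf : ∀ k, Measurable (f k)) {C : Fin d → ℝ}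
    (hC : ∀ k, ∀ u ∈ Icc (0 : ℝ) 1, |f k u| ≤ C k) :
    MemLp (fun u : Fin d → ℝ => ∏ k, f k (u k)) 2 (cubeMeasure d) := by
  refine MemLp.of_bound ?_ (∏ k, C k) ?_
  · exact (Finset.measurable_prod _ fun k _ =>
      (hf k).comp (measurable_pi_apply k)).aestronglyMeasurable
  · filter_upwards [ae_cubeMeasure_mem_Ico d] with u hu
    rw [Real.norm_eq_abs, Finset.abs_prod]
    exact Finset.prod_le_prod (fun _ _ => abs_nonneg _) fun k _ => hC k _ (Ico_subset_Icc_self (hu k))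

lemma memLp_tensorPow (q : ℕ) {d : ℕ} (v : Fin d → ℝ) :
    MemLp (tensorPow q v) 2 (cubeMeasure d) :=
  memLp_tensor (fun k => measurable_truncPow q (v k)) fun k _ hu => abs_truncPow_le q (v k) hu

/-- The tensor `ψ_{v₁} ⊗ ⋯ ⊗ ψ_{v_d}` as an element of `L²`. -/
noncomputable def tens (q : ℕ) {d : ℕ} (v : Fin d → ℝ) : L2Cube d := (memLp_tensorPow q v).toLp _

lemma coeFn_tens (q : ℕ) {d : ℕ} (v : Fin d → ℝ) :
    tens q v =ᵐ[cubeMeasure d] tensorPow q v := MemLp.coeFn_toLp _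

/-- The closed unit cube. -/
def closedCube (d : ℕ) : Set (Fin d → ℝ) := {v | ∀ k, v k ∈ Icc (0 : ℝ) 1}

lemma norm_tens_le_one (q : ℕ) {d : ℕ} {v : Fin d → ℝ} (hv : v ∈ closedCube d) :
    ‖tens q v‖ ≤ 1 := by
  have h := norm_sq_eq_integral _ (coeFn_tens q v)
  have h1 : ∫ u, tensorPow q v u ^ 2 ∂cubeMeasure d ≤ ∫ _, (1 : ℝ) ∂cubeMeasure d := by
    refine integral_mono_ae ?_ (integrable_const _) ?_
    · exact (memLp_tensorPow q v).integrable_sq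
    · filter_upwards [ae_cubeMeasure_mem_Ico d] with u hu
      rw [sq_le_one_iff_abs_le_one, tensorPow, Finset.abs_prod]
      exact Finset.prod_le_one (fun _ _ => abs_nonneg _)
        fun k _ => abs_truncPow_le_one q (hv k) (Ico_subset_Icc_self (hu k))
  have h2 : ∫ _, (1 : ℝ) ∂cubeMeasure d = 1 := by simp
  rw [← h, h2] at h1
  exact (sq_le_one_iff₀ (norm_nonneg _)).1 h1

/-- The tensors and their negatives. -/
def signedTensors (q d : ℕ) : Set (L2Cube d) :=
  tens q '' closedCube d ∪ (fun v => -tens q v) '' closedCube d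

lemma tens_mem_signedTensors (q : ℕ) {d : ℕ} {v : Fin d → ℝ} (hv : v ∈ closedCube d) :
    tens q v ∈ signedTensors q d := Or.inl ⟨v, hv, rfl⟩

lemma neg_tens_mem_signedTensors (q : ℕ) {d : ℕ} {v : Fin d → ℝ} (hv : v ∈ closedCube d) :
    -tens q v ∈ signedTensors q d := Or.inr ⟨v, hv, rfl⟩

lemma zero_mem_convexHull_signedTensors (q d : ℕ) :
    (0 : L2Cube d) ∈ convexHull ℝ (signedTensors q d) := by
  have hv : (0 : Fin d → ℝ) ∈ closedCube d := fun k => by simp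
  have h := (convex_convexHull ℝ (signedTensors q d))
    (subset_convexHull ℝ _ (tens_mem_signedTensors q hv))
    (subset_convexHull ℝ _ (neg_tens_mem_signedTensors q hv))
    (show (0 : ℝ) ≤ 1 / 2 by norm_num) (show (0 : ℝ) ≤ 1 / 2 by norm_num) (by norm_num)
  simpa using h

/-- Signs go into the generators, and a total weight `t < 1` is a contraction towards `0`, which
lies in the hull. -/
lemma sum_smul_tens_mem_convexHull (q : ℕ) {d : ℕ} (s : Finset (Fin d → ℝ))
    (β : (Fin d → ℝ) → ℝ) (hs : ∀ v ∈ s, v ∈ closedCube d) (hβ : ∑ v ∈ s, |β v| ≤ 1) :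
    ∑ v ∈ s, β v • tens q v ∈ convexHull ℝ (signedTensors q d) := by
  set t := ∑ v ∈ s, |β v| with ht
  have ht0 : 0 ≤ t := Finset.sum_nonneg fun _ _ => abs_nonneg _
  rcases ht0.eq_or_lt with h0 | h0
  · have hz := (Finset.sum_eq_zero_iff_of_nonneg fun v _ => abs_nonneg (β v)).1 (ht ▸ h0.symm)
    rw [Finset.sum_eq_zero fun v hv => by rw [abs_eq_zero.1 (hz v hv), zero_smul]]
    exact zero_mem_convexHull_signedTensors q d
  · have e : ∑ v ∈ s, β v • tens q v =
        t • ∑ v ∈ s, (|β v| / t) • (if 0 ≤ β v then tens q v else -tens q v) := by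
      rw [Finset.smul_sum]
      refine Finset.sum_congr rfl fun v _ => ?_
      rw [smul_smul, mul_div_cancel₀ _ h0.ne']
      split_ifs with h
      · rw [abs_of_nonneg h]
      · rw [abs_of_neg (not_le.1 h), smul_neg, neg_smul, neg_neg]
    rw [e]
    refine (convex_convexHull ℝ _).smul_mem_of_zero_mem (zero_mem_convexHull_signedTensors q d)
      ?_ ⟨ht0, hβ⟩
    refine (convex_convexHull ℝ _).sum_mem (fun v _ => by positivity) ?_ fun v hv => ?_
    · rw [← Finset.sum_div, ← ht, div_self h0.ne']
    · refine subset_convexHull ℝ _ ?_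
      split_ifs
      · exact tens_mem_signedTensors q (hs v hv)
      · exact neg_tens_mem_signedTensors q (hs v hv)

lemma coeFn_sum_smul_tens (q : ℕ) {d : ℕ} (s : Finset (Fin d → ℝ)) (β : (Fin d → ℝ) → ℝ) :
    (∑ v ∈ s, β v • tens q v : L2Cube d) =ᵐ[cubeMeasure d]
      fun u => ∑ v ∈ s, β v * tensorPow q v u := by
  have h : ∀ᵐ u ∂cubeMeasure d, ∀ v ∈ s, (β v • tens q v : L2Cube d) u = β v * tensorPow q v u := by
    refine (ae_ball_iff s.countable_toSet).2 fun v _ => ?_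
    filter_upwards [Lp.coeFn_smul (β v) (tens q v), coeFn_tens q v] with u h1 h2
    rw [h1, Pi.smul_apply, h2, smul_eq_mul]
  filter_upwards [Lp.coeFn_finsetSum s fun v => β v • tens q v, h] with u h1 h2
  rw [h1, Finset.sum_apply]
  exact Finset.sum_congr rfl h2

/-- The absolutely convex hull is the closed convex hull of the tensors and their negatives. -/
lemma absconvTensor_eq (q d : ℕ) :
    absconvTensor q d = closure (convexHull ℝ (signedTensors q d)) := by
  classical
  unfold absconvTensor
  congr 1
  refine Subset.antisymm ?_ ?_
  · rintro f ⟨V, β, hV, hβ, hf⟩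
    have e : f = ∑ v ∈ Fintype.piFinset V, β v • tens q v :=
      Lp.ext (hf.trans (coeFn_sum_smul_tens q _ β).symm)
    rw [e]
    exact sum_smul_tens_mem_convexHull q _ β
      (fun v hv k => hV k _ (Fintype.mem_piFinset.1 hv k)) hβ
  · have key : ∀ (c : ℝ), |c| ≤ 1 → ∀ v ∈ closedCube d, c • tens q v ∈
        {f : L2Cube d | ∃ (V : Fin d → Finset ℝ) (β : (Fin d → ℝ) → ℝ),
          (∀ k, ∀ t ∈ V k, t ∈ Icc (0 : ℝ) 1) ∧ ∑ v ∈ Fintype.piFinset V, |β v| ≤ 1 ∧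
          f =ᵐ[cubeMeasure d] fun u => ∑ v ∈ Fintype.piFinset V, β v * tensorPow q v u} := by
      intro c hc v hv
      refine ⟨fun k => {v k}, fun _ => c, fun k t ht => ?_, ?_, ?_⟩
      · rw [Finset.mem_singleton.1 ht]; exact hv k
      · simpa using hc
      · have := coeFn_sum_smul_tens q {v} fun _ => c
        simpa using this
    refine convexHull_min ?_ ?_
    · rintro _ (⟨v, hv, rfl⟩ | ⟨v, hv, rfl⟩)
      · simpa using key 1 (by simp) v hv
      · simpa using key (-1) (by simp) v hv
    · rintro f ⟨V, β, hV, hβ, hf⟩ g ⟨V', β', hV', hβ', hg⟩ a b ha hb hab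
      -- The product of the unions contains both product grids, and the coefficients are extended to
      -- it by zero.
      refine ⟨fun k => V k ∪ V' k, fun v => a * (if v ∈ Fintype.piFinset V then β v else 0) +
        b * (if v ∈ Fintype.piFinset V' then β' v else 0), fun k t ht => ?_, ?_, ?_⟩
      · rcases Finset.mem_union.1 ht with h | h
        · exact hV k t h
        · exact hV' k t h
      all_goals
        have hs : Fintype.piFinset V ⊆ Fintype.piFinset fun k => V k ∪ V' k :=
          Fintype.piFinset_subset _ _ fun k => Finset.subset_union_left
        have hs' : Fintype.piFinset V' ⊆ Fintype.piFinset fun k => V k ∪ V' k :=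
          Fintype.piFinset_subset _ _ fun k => Finset.subset_union_right
      · calc _ ≤ ∑ v ∈ Fintype.piFinset fun k => V k ∪ V' k,
              (a * (if v ∈ Fintype.piFinset V then |β v| else 0) +
                b * (if v ∈ Fintype.piFinset V' then |β' v| else 0)) := by
              refine Finset.sum_le_sum fun v _ => (abs_add_le _ _).trans (le_of_eq ?_)
              rw [abs_mul, abs_mul, abs_of_nonneg ha, abs_of_nonneg hb]
              congr 2 <;> split_ifs <;> simp
          _ = a * ∑ v ∈ Fintype.piFinset V, |β v| + b * ∑ v ∈ Fintype.piFinset V', |β' v| := by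
              rw [Finset.sum_add_distrib, ← Finset.mul_sum, ← Finset.mul_sum,
                Finset.sum_ite_mem, Finset.sum_ite_mem, Finset.inter_eq_right.2 hs,
                Finset.inter_eq_right.2 hs']
          _ ≤ a * 1 + b * 1 := by gcongr
          _ = 1 := by linarith
      · filter_upwards [Lp.coeFn_add (a • f) (b • g), Lp.coeFn_smul a f, Lp.coeFn_smul b g, hf, hg]
          with u h1 h2 h3 h4 h5
        rw [h1, Pi.add_apply, h2, h3, Pi.smul_apply, Pi.smul_apply, h4, h5]
        simp only [smul_eq_mul, add_mul, Finset.sum_add_distrib, mul_assoc, ← Finset.mul_sum,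
          ite_mul, zero_mul]
        rw [Finset.sum_ite_mem, Finset.sum_ite_mem, Finset.inter_eq_right.2 hs,
                Finset.inter_eq_right.2 hs']

end TruncPow

/-! ### Dyadic layers of a truncated power -/

section DyadicLayers

/-- Dyadic intervals are nested: the coarse index is the quotient of the fine one by a power of two.
-/
lemma floor_two_pow_mul_congr {u v : ℝ} {i j : ℕ} (hij : i ≤ j)
    (h : ⌊2 ^ j * u⌋₊ = ⌊2 ^ j * v⌋₊) : ⌊2 ^ i * u⌋₊ = ⌊2 ^ i * v⌋₊ := by
  have e : ∀ x : ℝ, ⌊2 ^ i * x⌋₊ = ⌊2 ^ j * x⌋₊ / 2 ^ (j - i) := fun x => by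
    rw [← Nat.floor_div_natCast]
    congr 1
    push_cast
    rw [eq_div_iff (by positivity), mul_right_comm, ← pow_add, Nat.add_sub_cancel' hij]
  rw [e, e, h]

open Classical in
/-- The part of `ψ_v` on the points that share the dyadic interval of length `2⁻ʲ` with `v`, but,
for `j ≤ n`, not that of length `2⁻ʲ⁻¹`. -/
noncomputable def layer (q : ℕ) (v : ℝ) (n j : ℕ) (u : ℝ) : ℝ :=
  if ⌊2 ^ j * u⌋₊ = ⌊2 ^ j * v⌋₊ ∧ (j ≤ n → ⌊2 ^ (j + 1) * u⌋₊ ≠ ⌊2 ^ (j + 1) * v⌋₊)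
  then truncPow q v u else 0

lemma measurable_layer (q : ℕ) (v : ℝ) (n j : ℕ) : Measurable (layer q v n j) := by
  have h : ∀ i : ℕ, MeasurableSet {u : ℝ | ⌊2 ^ i * u⌋₊ = ⌊2 ^ i * v⌋₊} := fun i =>
    (Nat.measurable_floor.comp (measurable_id.const_mul ((2 : ℝ) ^ i)))
      (measurableSet_singleton ⌊2 ^ i * v⌋₊)
  unfold layer
  refine Measurable.ite ((h j).inter ?_) (measurable_truncPow q v) measurable_const
  by_cases hj : j ≤ n
  · simp only [hj, forall_const]
    exact (h (j + 1)).compl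
  · simp only [hj, false_imp_iff]
    exact MeasurableSet.univ

lemma abs_layer_le (q : ℕ) (v : ℝ) (n j : ℕ) (u : ℝ) : |layer q v n j u| ≤ |truncPow q v u| := by
  unfold layer
  split_ifs
  · exact le_rfl
  · simp

/-- The sum telescopes: layer `j ≤ n` is the part of `ψ_v` on the level `j` interval of `v` minus
that at level `j + 1`, and the last layer is what remains. -/
lemma sum_layer (q : ℕ) {v u : ℝ} (hv : v ∈ Icc (0 : ℝ) 1) (hu : u ∈ Ico (0 : ℝ) 1) (n : ℕ) :
    ∑ j ∈ Finset.range (n + 2), layer q v n j u = truncPow q v u := by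
  classical
  set p : ℕ → ℝ := fun j => if ⌊2 ^ j * u⌋₊ = ⌊2 ^ j * v⌋₊ then truncPow q v u else 0 with hp
  have h1 : ∀ j ∈ Finset.range (n + 1), layer q v n j u = p j - p (j + 1) := fun j hj => by
    have hj' : j ≤ n := Nat.lt_succ_iff.1 (Finset.mem_range.1 hj)
    have hn := floor_two_pow_mul_congr (u := u) (v := v) (Nat.le_succ j)
    simp only [layer, hp, hj', forall_const]
    by_cases h : ⌊2 ^ (j + 1) * u⌋₊ = ⌊2 ^ (j + 1) * v⌋₊
    · simp [h, hn h]
    · simp [h]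
  have h2 : layer q v n (n + 1) u = p (n + 1) := by simp [layer, hp]
  rw [Finset.sum_range_succ, Finset.sum_congr rfl h1, Finset.sum_range_sub', h2, sub_add_cancel]
  have hu0 : ⌊u⌋₊ = 0 := Nat.floor_eq_zero.2 hu.2
  simp only [hp, pow_zero, one_mul, hu0]
  -- At `v = 1` no point of `[0, 1)` shares the level `0` interval with `v`, but `ψ_1` vanishes
  -- there.
  rcases hv.2.eq_or_lt with h | h
  · have : truncPow q v u = 0 := by
      unfold truncPow; rw [if_neg]; rw [h]; exact not_le.2 hu.2
    simp [this]
  · rw [if_pos (Nat.floor_eq_zero.2 h).symm]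

/-- The finer layer lives in the level `i + 1` interval of `v`, which layer `i` excludes. -/
lemma layer_mul_layer (q : ℕ) (v : ℝ) (n : ℕ) {i j : ℕ} (hij : i ≠ j) (hi : i ≤ n + 1)
    (hj : j ≤ n + 1) (u : ℝ) : layer q v n i u * layer q v n j u = 0 := by
  wlog h : i < j generalizing i j
  · rw [mul_comm]; exact this hij.symm hj hi (by omega)
  unfold layer
  by_cases h1 : ⌊2 ^ (i + 1) * u⌋₊ = ⌊2 ^ (i + 1) * v⌋₊
  · rw [if_neg fun hc => hc.2 (by omega) h1, zero_mul]
  · rw [mul_comm, if_neg fun hc => h1 (floor_two_pow_mul_congr h hc.1), zero_mul]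

/-- The layer lives on `[v, v + 2⁻ʲ]`, where `ψ_v ^ 2 ≤ 2 ^ (-2 * j * (q - 1))`; the length supplies
one more factor `2⁻ʲ`. -/
lemma integral_layer_sq_le {q : ℕ} (hq : 1 ≤ q) {v : ℝ} (hv : v ∈ Icc (0 : ℝ) 1) (n j : ℕ) :
    ∫ u, layer q v n j u ^ 2 ∂unitMeasure ≤ (1 / 2 ^ (2 * q - 1)) ^ j := by
  have hb : ∀ u ∈ Icc (0 : ℝ) 1, layer q v n j u ^ 2 ≤
      (Icc v (v + 1 / 2 ^ j)).indicator (fun _ => (1 / 2 ^ j : ℝ) ^ (2 * (q - 1))) u := by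
    intro u hu
    by_cases hc : ⌊2 ^ j * u⌋₊ = ⌊2 ^ j * v⌋₊ ∧ v ≤ u
    · have h1 : u - v ≤ 1 / 2 ^ j := by
        have h2 := Nat.lt_floor_add_one ((2 : ℝ) ^ j * u)
        have h3 := Nat.floor_le (show 0 ≤ (2 : ℝ) ^ j * v from mul_nonneg (by positivity) hv.1)
        rw [hc.1] at h2
        rw [le_div_iff₀ (by positivity)]
        nlinarith
      rw [indicator_of_mem (show u ∈ Icc v (v + 1 / 2 ^ j) from ⟨hc.2, by linarith⟩), ← sq_abs]
      refine (pow_le_pow_left₀ (abs_nonneg _) (abs_layer_le q v n j u) 2).trans ?_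
      rw [sq_abs, truncPow, if_pos hc.2, ← pow_mul, mul_comm]
      exact pow_le_pow_left₀ (sub_nonneg.2 hc.2) h1 _
    · have h0 : layer q v n j u = 0 := by
        unfold layer
        split_ifs with h
        · unfold truncPow
          rw [if_neg fun hvu => hc ⟨h.1, hvu⟩]
        · rfl
      rw [h0]
      exact (by norm_num : (0 : ℝ) ^ 2 = 0).le.trans (indicator_nonneg (fun _ _ => by positivity) _)
  calc ∫ u, layer q v n j u ^ 2 ∂unitMeasure
      ≤ ∫ u, (Icc v (v + 1 / 2 ^ j)).indicator (fun _ => (1 / 2 ^ j : ℝ) ^ (2 * (q - 1))) u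
          ∂unitMeasure := by
        refine integral_mono_of_nonneg (Eventually.of_forall fun _ => sq_nonneg _)
          ((integrable_const _).indicator measurableSet_Icc) ?_
        filter_upwards [ae_unitMeasure_mem_Ico] with u hu using hb u (Ico_subset_Icc_self hu)
    _ = unitMeasure.real (Icc v (v + 1 / 2 ^ j)) * (1 / 2 ^ j : ℝ) ^ (2 * (q - 1)) := by
        rw [integral_indicator_const _ measurableSet_Icc, smul_eq_mul]
    _ ≤ (1 / 2 ^ j) * (1 / 2 ^ j : ℝ) ^ (2 * (q - 1)) := by
        gcongr
        refine (ENNReal.toReal_mono (by simp) (Measure.restrict_le_self _)).trans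
          (le_of_eq ?_)
        change volume.real _ = _
        rw [Real.volume_real_Icc_of_le (le_add_of_nonneg_right (by positivity))]
        ring
    _ = _ := by
        rw [← pow_succ', show 2 * (q - 1) + 1 = 2 * q - 1 by omega, one_div_pow, one_div_pow,
          ← pow_mul, ← pow_mul, mul_comm]

/-- The monomial `u ↦ u ^ p` on the dyadic interval with number `i` at level `j + 1`. -/
noncomputable def localMonomial (j : ℕ) (x : ℕ × ℕ) (u : ℝ) : ℝ :=
  if ⌊2 ^ (j + 1) * u⌋₊ = x.1 then u ^ x.2 else 0

lemma measurable_localMonomial (j : ℕ) (x : ℕ × ℕ) : Measurable (localMonomial j x) := by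
  unfold localMonomial
  exact Measurable.ite ((Nat.measurable_floor.comp (measurable_id.const_mul ((2 : ℝ) ^ (j + 1))))
      (measurableSet_singleton x.1)) (by fun_prop) measurable_const

lemma abs_localMonomial_le_one (j : ℕ) (x : ℕ × ℕ) {u : ℝ} (hu : u ∈ Icc (0 : ℝ) 1) :
    |localMonomial j x u| ≤ 1 := by
  unfold localMonomial
  split_ifs
  · rw [abs_of_nonneg (pow_nonneg hu.1 _)]; exact pow_le_one₀ hu.1 hu.2
  · simp

/-- Such a layer avoids the level `j + 1` interval that contains the knot, so on each interval of
that level it is zero or a full polynomial of degree `q - 1`. The monomials do not depend on `v`;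
only `c` does. -/
lemma exists_layer_eq_sum {q : ℕ} (hq : 1 ≤ q) {v : ℝ} {n j : ℕ}
    (hj : j ≤ n) : ∃ c : ℕ × ℕ → ℝ, ∀ u ∈ Ico (0 : ℝ) 1, layer q v n j u =
      ∑ x ∈ Finset.range (2 ^ (j + 1)) ×ˢ Finset.range q, c x * localMonomial j x u := by
  classical
  set m := ⌊2 ^ (j + 1) * v⌋₊ with hm
  -- The condition selects the right sibling of the interval of `v`; the coefficients are those of
  -- the binomial expansion of `(u - v) ^ (q - 1)`.
  refine ⟨fun x => if x.1 / 2 = m / 2 ∧ m < x.1 then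
    (-v) ^ (q - 1 - x.2) * ((q - 1).choose x.2) else 0, fun u hu => ?_⟩
  have hlt : ⌊2 ^ (j + 1) * u⌋₊ < 2 ^ (j + 1) := by
    rw [Nat.floor_lt (mul_nonneg (by positivity) hu.1)]
    push_cast
    nlinarith [hu.2, pow_pos (show (0 : ℝ) < 2 by norm_num) (j + 1)]
  have hhalf : ∀ x : ℝ, ⌊2 ^ j * x⌋₊ = ⌊2 ^ (j + 1) * x⌋₊ / 2 := fun x => by
    rw [← Nat.floor_div_ofNat]
    congr 1
    rw [pow_succ]; ring_nf
  rw [Finset.sum_product, Finset.sum_eq_single_of_mem _ (Finset.mem_range.2 hlt)]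
  · have hiff : (⌊2 ^ j * u⌋₊ = ⌊2 ^ j * v⌋₊ ∧
        (j ≤ n → ⌊2 ^ (j + 1) * u⌋₊ ≠ ⌊2 ^ (j + 1) * v⌋₊)) ∧ v ≤ u ↔
        ⌊2 ^ (j + 1) * u⌋₊ / 2 = m / 2 ∧ m < ⌊2 ^ (j + 1) * u⌋₊ := by
      rw [hhalf, hhalf, ← hm]
      constructor
      · rintro ⟨⟨h1, h2⟩, h3⟩
        refine ⟨h1, lt_of_le_of_ne ?_ (h2 hj).symm⟩
        exact Nat.floor_mono (by gcongr)
      · rintro ⟨h1, h2⟩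
        refine ⟨⟨h1, fun _ => h2.ne'⟩, ?_⟩
        by_contra hvu
        have : ⌊2 ^ (j + 1) * u⌋₊ ≤ m := Nat.floor_mono (by push Not at hvu; gcongr)
        omega
    simp only [localMonomial, if_true]
    unfold layer truncPow
    rw [← ite_and]
    by_cases h : ⌊2 ^ (j + 1) * u⌋₊ / 2 = m / 2 ∧ m < ⌊2 ^ (j + 1) * u⌋₊
    · rw [if_pos (hiff.2 h), sub_eq_add_neg, add_pow, Nat.sub_add_cancel hq]
      refine Finset.sum_congr rfl fun p _ => ?_
      rw [if_pos h]; ring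
    · rw [if_neg (fun hc => h (hiff.1 hc))]
      refine (Finset.sum_eq_zero fun p _ => ?_).symm
      rw [if_neg h, zero_mul]
  · intro i _ hi
    refine Finset.sum_eq_zero fun p _ => ?_
    rw [localMonomial, if_neg (fun hc => hi hc.symm), mul_zero]

end DyadicLayers

/-! ### Sums over the hyperbolic cross -/

section Counting

/-- A sum over a cube of multi-indices of a function of the total degree. -/
lemma sum_piFinset_range_le (D N : ℕ) (f : ℕ → ℝ) {b : ℝ}
    (hb : ∀ s, ∑ a ∈ Finset.range N, f (a + s) ≤ b) :
    ∑ j ∈ Fintype.piFinset (fun _ : Fin (D + 1) => Finset.range N), f (∑ k, j k) ≤ N ^ D * b := by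
  have e : ∑ j ∈ Fintype.piFinset (fun _ : Fin (D + 1) => Finset.range N), f (∑ k, j k) =
      ∑ x ∈ Fintype.piFinset (fun _ : Fin D => Finset.range N) ×ˢ Finset.range N,
        f (x.2 + ∑ k, x.1 k) := by
    refine (Finset.sum_bij' (fun x _ => (Fin.cons x.2 x.1 : Fin (D + 1) → ℕ))
      (fun j _ => (Fin.tail j, j 0)) ?_ ?_ ?_ ?_ ?_).symm
    · rintro ⟨x, a⟩ h
      simp only [Finset.mem_product, Fintype.mem_piFinset] at h ⊢
      exact Fin.cases (by simpa using h.2) (by simpa using h.1)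
    · intro j h
      simp only [Finset.mem_product, Fintype.mem_piFinset] at h ⊢
      exact ⟨fun k => h k.succ, h 0⟩
    · rintro ⟨x, a⟩ _; simp
    · intro j _; simp
    · rintro ⟨x, a⟩ _; simp [Fin.sum_univ_succ]
  rw [e, Finset.sum_product]
  refine (Finset.sum_le_sum fun x _ => hb _).trans (le_of_eq ?_)
  rw [Finset.sum_const, Fintype.card_piFinset]
  simp

/-- A geometric sum is of the order of its largest term, uniformly in `s`. One of the `d`
coordinates thus costs no logarithm, which gives the power `d - 1`. -/
lemma sum_range_two_pow_le (n N s : ℕ) :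
    ∑ a ∈ Finset.range N, (if a + s ≤ n then (2 : ℝ) ^ (a + s) else 0) ≤ 2 ^ (n + 1) := by
  calc ∑ a ∈ Finset.range N, (if a + s ≤ n then (2 : ℝ) ^ (a + s) else 0)
      ≤ ∑ m ∈ Finset.range (n + 1), (2 : ℝ) ^ m := by
        rw [← Finset.sum_filter]
        rw [← Finset.sum_image (f := fun m => (2 : ℝ) ^ m) (g := fun a => a + s)
          (fun a _ b _ h => by simpa using h)]
        refine Finset.sum_le_sum_of_subset_of_nonneg (fun m hm => ?_) fun _ _ _ => by positivity
        simp only [Finset.mem_image, Finset.mem_filter, Finset.mem_range] at hm ⊢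
        omega
    _ ≤ 2 ^ (n + 1) := by
        rw [geom_sum_eq (by norm_num)]
        norm_num

lemma sum_range_pow_tail_le {c : ℝ} (hc0 : 0 ≤ c) (hc : c ≤ 1 / 2) (n N s : ℕ) :
    ∑ a ∈ Finset.range N, (if a + s ≤ n then 0 else c ^ (a + s)) ≤ 2 * c ^ (n + 1) := by
  calc ∑ a ∈ Finset.range N, (if a + s ≤ n then 0 else c ^ (a + s))
      ≤ ∑ m ∈ Finset.Ico (n + 1) (N + s + n + 1), c ^ m := by
        simp only [← ite_not (p := _ ≤ n)]
        rw [← Finset.sum_filter]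
        rw [← Finset.sum_image (f := fun m => c ^ m) (g := fun a => a + s)
          (fun a _ b _ h => by simpa using h)]
        refine Finset.sum_le_sum_of_subset_of_nonneg (fun m hm => ?_) fun _ _ _ => by positivity
        simp only [Finset.mem_image, Finset.mem_filter, Finset.mem_range, Finset.mem_Ico] at hm ⊢
        omega
    _ ≤ c ^ (n + 1) / (1 - c) := geom_sum_Ico_le_of_lt_one hc0 (by linarith)
    _ ≤ 2 * c ^ (n + 1) := by
        rw [div_le_iff₀ (by linarith)]
        nlinarith [pow_nonneg hc0 (n + 1)]

end Counting

/-! ### Approximation from the hyperbolic cross -/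

section Approximation

variable {d : ℕ}

lemma memLp_tensor_localMonomial (j : Fin d → ℕ) (x : Fin d → ℕ × ℕ) :
    MemLp (fun u : Fin d → ℝ => ∏ k, localMonomial (j k) (x k) (u k)) 2 (cubeMeasure d) :=
  memLp_tensor (fun k => measurable_localMonomial (j k) (x k))
    fun k _ hu => abs_localMonomial_le_one (j k) (x k) hu

lemma memLp_tensor_layer (q : ℕ) (v : Fin d → ℝ) (n : ℕ) (j : Fin d → ℕ) :
    MemLp (fun u : Fin d → ℝ => ∏ k, layer q (v k) n (j k) (u k)) 2 (cubeMeasure d) :=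
  memLp_tensor (fun k => measurable_layer q (v k) n (j k))
    fun k u hu => (abs_layer_le q (v k) n (j k) u).trans (abs_truncPow_le q (v k) hu)

/-- Indices of the local monomials of total level at most `n`. -/
def monomialIndex (q d n : ℕ) : Finset ((_ : Fin d → ℕ) × (Fin d → ℕ × ℕ)) :=
  ((Fintype.piFinset fun _ : Fin d => Finset.range (n + 2)).filter fun j => ∑ k, j k ≤ n).sigma
    fun j => Fintype.piFinset fun k => Finset.range (2 ^ (j k + 1)) ×ˢ Finset.range q

/-- Coordinate `k` contributes `2 ^ (j k + 1)` intervals with `q` monomials each, so `j` accounts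
for `(2 * q) ^ (D + 1) * 2 ^ (∑ k, j k)` indices. -/
lemma card_monomialIndex_le (q D n : ℕ) :
    (monomialIndex q (D + 1) n).card ≤ 2 ^ (2 * D + 2) * q ^ (D + 1) * (2 ^ n * (n + 1) ^ D) := by
  have h1 : ((monomialIndex q (D + 1) n).card : ℝ) = (2 * q) ^ (D + 1) *
      ∑ j ∈ Fintype.piFinset (fun _ : Fin (D + 1) => Finset.range (n + 2)),
        (if ∑ k, j k ≤ n then (2 : ℝ) ^ (∑ k, j k) else 0) := by
    rw [monomialIndex, Finset.card_sigma, ← Finset.sum_filter, Finset.mul_sum]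
    push_cast
    refine Finset.sum_congr rfl fun j _ => ?_
    rw [Fintype.card_piFinset]
    simp only [Finset.card_product, Finset.card_range]
    push_cast
    rw [Finset.prod_mul_distrib, Finset.prod_const, Finset.card_univ, Fintype.card_fin,
      Finset.prod_pow_eq_pow_sum, Finset.sum_add_distrib, pow_add, mul_pow]
    simp
    ring
  have h2 := sum_piFinset_range_le D (n + 2) (fun m => if m ≤ n then (2 : ℝ) ^ m else 0)
    (sum_range_two_pow_le n (n + 2))
  have h3 : ((n + 2 : ℕ) : ℝ) ^ D ≤ 2 ^ D * (n + 1) ^ D := by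
    rw [← mul_pow]
    refine pow_le_pow_left₀ (by positivity) ?_ D
    push_cast; linarith [(Nat.cast_nonneg n : (0 : ℝ) ≤ n)]
  have h4 : ((monomialIndex q (D + 1) n).card : ℝ) ≤
      2 ^ (2 * D + 2) * q ^ (D + 1) * (2 ^ n * (n + 1) ^ D) := by
    rw [h1]
    calc _ ≤ (2 * (q : ℝ)) ^ (D + 1) * ((2 ^ D * (n + 1) ^ D) * 2 ^ (n + 1)) := by
          refine mul_le_mul_of_nonneg_left (h2.trans ?_) (by positivity)
          gcongr
      _ = _ := by rw [mul_pow]; ring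
  exact_mod_cast h4

/-- The span of the tensor products of local monomials of total level at most `n`. -/
noncomputable def hyperbolicCross (q d n : ℕ) : Submodule ℝ (L2Cube d) :=
  Submodule.span ℝ (Set.range fun x : monomialIndex q d n =>
    (memLp_tensor_localMonomial x.1.1 x.1.2).toLp _)

lemma tensor_layer_mem_hyperbolicCross {q : ℕ} (hq : 1 ≤ q) (v : Fin d → ℝ) (n : ℕ)
    {j : Fin d → ℕ} (hj : ∑ k, j k ≤ n) :
    (memLp_tensor_layer q v n j).toLp _ ∈ hyperbolicCross q d n := by
  -- Total level at most `n` excludes the last layer `n + 1` in every coordinate, the only one that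
  -- may not be piecewise polynomial on the grid.
  have hjk : ∀ k, j k ≤ n := fun k =>
    (Finset.single_le_sum (fun _ _ => Nat.zero_le _) (Finset.mem_univ k)).trans hj
  choose c hc using fun k => exists_layer_eq_sum hq (v := v k) (hjk k)
  set I := Fintype.piFinset fun k => Finset.range (2 ^ (j k + 1)) ×ˢ Finset.range q with hI
  have e : (memLp_tensor_layer q v n j).toLp _ =
      ∑ x ∈ I, (∏ k, c k (x k)) • (memLp_tensor_localMonomial j x).toLp _ := by
    refine Lp.ext ?_
    have h : ∀ᵐ u ∂cubeMeasure d, ∀ x ∈ I,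
        ((∏ k, c k (x k)) • (memLp_tensor_localMonomial j x).toLp _ : L2Cube d) u =
          (∏ k, c k (x k)) * ∏ k, localMonomial (j k) (x k) (u k) := by
      refine (ae_ball_iff I.countable_toSet).2 fun x _ => ?_
      filter_upwards [Lp.coeFn_smul (∏ k, c k (x k)) ((memLp_tensor_localMonomial j x).toLp _),
        (memLp_tensor_localMonomial j x).coeFn_toLp] with u h1 h2
      rw [h1, Pi.smul_apply, h2, smul_eq_mul]
    filter_upwards [Lp.coeFn_finsetSum I fun x =>
      (∏ k, c k (x k)) • (memLp_tensor_localMonomial j x).toLp _, h,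
      (memLp_tensor_layer q v n j).coeFn_toLp, ae_cubeMeasure_mem_Ico d] with u h1 h2 h3 h4
    rw [h1, h3, Finset.sum_apply, Finset.sum_congr rfl h2]
    rw [Finset.prod_congr rfl fun k _ => hc k (u k) (h4 k), Finset.prod_univ_sum]
    exact Finset.sum_congr rfl fun x _ => Finset.prod_mul_distrib
  rw [e]
  refine Submodule.sum_mem _ fun x hx => Submodule.smul_mem _ _ (Submodule.subset_span ?_)
  refine ⟨⟨⟨j, x⟩, ?_⟩, rfl⟩
  simp only [monomialIndex, Finset.mem_sigma, Finset.mem_filter]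
  refine ⟨⟨Fintype.mem_piFinset.2 fun k => Finset.mem_range.2 ?_, hj⟩, hx⟩
  have := hjk k
  omega

/-- Approximation of the tensors from the hyperbolic cross. -/
lemma exists_mem_hyperbolicCross_norm_sub_le {q : ℕ} (hq : 1 ≤ q) (D n : ℕ)
    {v : Fin (D + 1) → ℝ} (hv : v ∈ closedCube (D + 1)) :
    ∃ g ∈ hyperbolicCross q (D + 1) n,
      ‖tens q v - g‖ ^ 2 ≤ 2 ^ (D + 1) * (n + 1) ^ D / 2 ^ (n * (2 * q - 1)) := by
  classical
  set J := Fintype.piFinset fun _ : Fin (D + 1) => Finset.range (n + 2) with hJ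
  set a : (Fin (D + 1) → ℕ) → (Fin (D + 1) → ℝ) → ℝ :=
    fun j u => ∏ k, layer q (v k) n (j k) (u k) with ha
  refine ⟨∑ j ∈ J.filter fun j => ∑ k, j k ≤ n, (memLp_tensor_layer q v n j).toLp _,
    Submodule.sum_mem _ fun j hj =>
      tensor_layer_mem_hyperbolicCross hq v n (Finset.mem_filter.1 hj).2, ?_⟩
  set J' := J.filter fun j => ¬ ∑ k, j k ≤ n with hJ'
  have herr : (tens q v - ∑ j ∈ J.filter fun j => ∑ k, j k ≤ n,
      (memLp_tensor_layer q v n j).toLp _ : L2Cube (D + 1)) =ᵐ[cubeMeasure (D + 1)]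
        fun u => ∑ j ∈ J', a j u := by
    have h : ∀ᵐ u ∂cubeMeasure (D + 1), ∀ j ∈ J.filter fun j => ∑ k, j k ≤ n,
        ((memLp_tensor_layer q v n j).toLp _ : L2Cube (D + 1)) u = a j u :=
      (ae_ball_iff (Finset.countable_toSet _)).2 fun j _ => (memLp_tensor_layer q v n j).coeFn_toLp
    filter_upwards [Lp.coeFn_sub (tens q v) (∑ j ∈ J.filter fun j => ∑ k, j k ≤ n,
      (memLp_tensor_layer q v n j).toLp _), coeFn_tens q v,
      Lp.coeFn_finsetSum (J.filter fun j => ∑ k, j k ≤ n)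
        fun j => (memLp_tensor_layer q v n j).toLp _, h, ae_cubeMeasure_mem_Ico (D + 1)]
      with u h1 h2 h3 h4 h5
    rw [h1, Pi.sub_apply, h2, h3, Finset.sum_apply, Finset.sum_congr rfl h4, sub_eq_iff_eq_add',
      hJ', Finset.sum_filter_add_sum_filter_not, tensorPow]
    rw [Finset.prod_congr rfl fun k _ => (sum_layer q (hv k) (h5 k) n).symm, Finset.prod_univ_sum]
  -- Distinct multi-indices differ in some coordinate, where the layers have disjoint supports.
  have horth : ∀ u, (∑ j ∈ J', a j u) ^ 2 = ∑ j ∈ J', a j u ^ 2 := by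
    intro u
    rw [sq, Finset.sum_mul_sum]
    refine Finset.sum_congr rfl fun i hi => ?_
    rw [Finset.sum_eq_single_of_mem i hi, sq]
    intro j hj hji
    obtain ⟨k, hk⟩ := Function.ne_iff.1 hji
    rw [ha, ← Finset.prod_mul_distrib]
    have hr : ∀ {i}, i ∈ J' → i k ≤ n + 1 := fun {i} hi => by
      have := Finset.mem_range.1 (Fintype.mem_piFinset.1 (Finset.mem_filter.1 hi).1 k)
      omega
    exact Finset.prod_eq_zero (Finset.mem_univ k)
      (layer_mul_layer q (v k) n hk.symm (hr hi) (hr hj) (u k))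
  set c : ℝ := 1 / 2 ^ (2 * q - 1) with hc
  have hc0 : 0 ≤ c := by positivity
  have hc2 : c ≤ 1 / 2 := by
    rw [hc]
    refine one_div_le_one_div_of_le (by norm_num) ?_
    exact le_self_pow₀ (by norm_num) (by omega)
  rw [norm_sq_eq_integral _ herr]
  calc ∫ u, (∑ j ∈ J', a j u) ^ 2 ∂cubeMeasure (D + 1)
      = ∑ j ∈ J', ∫ u, a j u ^ 2 ∂cubeMeasure (D + 1) := by
        simp only [horth]
        exact integral_finsetSum _ fun j _ => (memLp_tensor_layer q v n j).integrable_sq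
    _ = ∑ j ∈ J', ∏ k, ∫ u, layer q (v k) n (j k) u ^ 2 ∂unitMeasure := by
        refine Finset.sum_congr rfl fun j _ => ?_
        simp only [ha, ← Finset.prod_pow]
        exact integral_fintype_prod_eq_prod (fun k u => layer q (v k) n (j k) u ^ 2)
    _ ≤ ∑ j ∈ J', c ^ (∑ k, j k) := by
        refine Finset.sum_le_sum fun j _ => ?_
        rw [← Finset.prod_pow_eq_pow_sum]
        exact Finset.prod_le_prod (fun k _ => integral_nonneg fun _ => sq_nonneg _)
          fun k _ => integral_layer_sq_le hq (hv k) n (j k)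
    _ = ∑ j ∈ J, (if ∑ k, j k ≤ n then 0 else c ^ (∑ k, j k)) := by
        rw [hJ', Finset.sum_filter]
        simp only [ite_not]
    _ ≤ ((n + 2 : ℕ) : ℝ) ^ D * (2 * c ^ (n + 1)) :=
        sum_piFinset_range_le D (n + 2) (fun m => if m ≤ n then 0 else c ^ m)
          (sum_range_pow_tail_le hc0 hc2 n (n + 2))
    _ ≤ (2 ^ D * (n + 1) ^ D) * (2 * c ^ n) := by
        rw [← mul_pow]
        gcongr ?_ ^ D * (2 * ?_)
        · push_cast; linarith [(Nat.cast_nonneg n : (0 : ℝ) ≤ n)]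
        · exact pow_le_pow_of_le_one hc0 (by linarith) (Nat.le_succ n)
    _ = _ := by
        rw [hc, one_div_pow, ← pow_mul, mul_comm n, pow_succ]
        ring

end Approximation

/-! ### Nets of truncated powers and of their tensors -/

section Nets

lemma abs_truncPow_sub_le {q : ℕ} (hq : 2 ≤ q) {v w u : ℝ} (hv : v ∈ Icc (0 : ℝ) 1)
    (hw : w ∈ Icc (0 : ℝ) 1) (hu : u ∈ Icc (0 : ℝ) 1) :
    |truncPow q v u - truncPow q w u| ≤ q * |v - w| := by
  have e : ∀ x, truncPow q x u = (max (u - x) 0) ^ (q - 1) := fun x => by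
    unfold truncPow
    split_ifs with h
    · rw [max_eq_left (sub_nonneg.2 h)]
    · rw [max_eq_right (by linarith), zero_pow (by omega)]
  have hb : ∀ x ∈ Icc (0 : ℝ) 1, |max (u - x) 0| ≤ 1 := fun x hx => by
    rw [abs_of_nonneg (le_max_right _ _)]
    exact max_le (by linarith [hx.1, hu.2]) zero_le_one
  rw [e, e]
  refine (abs_pow_sub_pow_le _ _ _).trans ?_
  have h1 : |max (u - v) 0 - max (u - w) 0| ≤ |v - w| := by
    refine (abs_max_sub_max_le_abs _ _ _).trans (le_of_eq ?_)
    rw [sub_sub_sub_cancel_left, abs_sub_comm]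
  have h2 : max |max (u - v) 0| |max (u - w) 0| ^ (q - 1 - 1) ≤ 1 :=
    pow_le_one₀ (le_max_of_le_left (abs_nonneg _)) (max_le (hb v hv) (hb w hw))
  have h3 : ((q - 1 : ℕ) : ℝ) ≤ q := by exact_mod_cast Nat.sub_le q 1
  calc _ ≤ |v - w| * q * 1 := by gcongr
    _ = _ := by ring

lemma integrable_sq_truncPow_sub (q : ℕ) (v w : ℝ) :
    Integrable (fun u => (truncPow q v u - truncPow q w u) ^ 2) unitMeasure := by
  refine Integrable.of_bound (C := ((1 + |v|) ^ (q - 1) + (1 + |w|) ^ (q - 1)) ^ 2) ?_ ?_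
  · exact (((measurable_truncPow q v).sub
      (measurable_truncPow q w)).pow_const 2).aestronglyMeasurable
  · filter_upwards [ae_unitMeasure_mem_Ico] with u hu
    rw [norm_pow]
    refine pow_le_pow_left₀ (norm_nonneg _) ((norm_sub_le _ _).trans (add_le_add ?_ ?_)) 2
    · exact abs_truncPow_le q v (Ico_subset_Icc_self hu)
    · exact abs_truncPow_le q w (Ico_subset_Icc_self hu)

lemma integral_truncPow_sub_sq_le_sq {q : ℕ} (hq : 2 ≤ q) {v w : ℝ} (hv : v ∈ Icc (0 : ℝ) 1)
    (hw : w ∈ Icc (0 : ℝ) 1) :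
    ∫ u, (truncPow q v u - truncPow q w u) ^ 2 ∂unitMeasure ≤ (q * |v - w|) ^ 2 := by
  calc _ ≤ ∫ _, (q * |v - w|) ^ 2 ∂unitMeasure := by
        refine integral_mono_ae (integrable_sq_truncPow_sub q v w) (integrable_const _) ?_
        filter_upwards [ae_unitMeasure_mem_Ico] with u hu
        rw [← sq_abs]
        exact pow_le_pow_left₀ (abs_nonneg _)
          (abs_truncPow_sub_le hq hv hw (Ico_subset_Icc_self hu)) 2
    _ = _ := by simp

/-- For `q = 1` the difference is bounded by the indicator of the interval between the knots, whence
only `√|v - w|` in norm and `ε⁻²` in the covering number. For larger `q` the difference is at most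
`1`, so its square is at most the Lipschitz bound. -/
lemma integral_truncPow_sub_sq_le {q : ℕ} (hq : 1 ≤ q) {v w : ℝ} (hv : v ∈ Icc (0 : ℝ) 1)
    (hw : w ∈ Icc (0 : ℝ) 1) :
    ∫ u, (truncPow q v u - truncPow q w u) ^ 2 ∂unitMeasure ≤ q * |v - w| := by
  rcases hq.eq_or_lt with rfl | hq
  · have hpt : ∀ u, (truncPow 1 v u - truncPow 1 w u) ^ 2 ≤
        (uIcc v w).indicator (fun _ => (1 : ℝ)) u := by
      intro u
      by_cases hu : u ∈ uIcc v w
      · rw [indicator_of_mem hu]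
        unfold truncPow
        split_ifs <;> simp
      · rw [indicator_of_notMem hu]
        have : truncPow 1 v u = truncPow 1 w u := by
          unfold truncPow
          rw [mem_uIcc] at hu
          push Not at hu
          by_cases h1 : v ≤ u
          · have h2 : w ≤ u := (hu.1 h1).le
            simp [h1, h2]
          · have h2 : ¬ w ≤ u := fun h => h1 (hu.2 h).le
            simp [h1, h2]
        simp [this]
    calc _ ≤ ∫ u, (uIcc v w).indicator (fun _ => (1 : ℝ)) u ∂unitMeasure :=
          integral_mono (integrable_sq_truncPow_sub 1 v w)
            ((integrable_const _).indicator measurableSet_uIcc) hpt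
      _ = unitMeasure.real (uIcc v w) := by
          rw [integral_indicator_const _ measurableSet_uIcc, smul_eq_mul, mul_one]
      _ ≤ volume.real (uIcc v w) :=
          ENNReal.toReal_mono (by simp [uIcc]) (Measure.restrict_le_self _)
      _ = _ := by
          rw [uIcc, Real.volume_real_Icc_of_le min_le_max, max_sub_min_eq_abs, abs_sub_comm]
          simp
  · calc _ ≤ ∫ _, (q * |v - w|) ∂unitMeasure := by
          refine integral_mono_ae (integrable_sq_truncPow_sub q v w) (integrable_const _) ?_
          filter_upwards [ae_unitMeasure_mem_Ico] with u hu
          have hu' := Ico_subset_Icc_self hu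
          have h1 : |truncPow q v u - truncPow q w u| ≤ 1 := by
            have h2 := truncPow_nonneg q v u
            have h3 := truncPow_nonneg q w u
            have h4 := (le_abs_self _).trans (abs_truncPow_le_one q hv hu')
            have h5 := (le_abs_self _).trans (abs_truncPow_le_one q hw hu')
            rw [abs_le]; constructor <;> linarith
          rw [← sq_abs, sq]
          exact (mul_le_of_le_one_left (abs_nonneg _) h1).trans (abs_truncPow_sub_le hq hv hw hu')
      _ = _ := by simp

/-- The point of the grid of mesh `1 / N` below `t`. -/
lemma exists_grid_point {N : ℕ} (hN : 0 < N) {t : ℝ} (ht : t ∈ Icc (0 : ℝ) 1) :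
    ∃ i ∈ Finset.range (N + 1), ((i : ℝ) / N) ∈ Icc (0 : ℝ) 1 ∧ |t - i / N| ≤ 1 / N := by
  have hN0 : (0 : ℝ) < N := by exact_mod_cast hN
  have h1 := Nat.floor_le (show 0 ≤ N * t from mul_nonneg hN0.le ht.1)
  have h2 := Nat.lt_floor_add_one (N * t)
  have h3 : (⌊N * t⌋₊ : ℝ) ≤ N := h1.trans (mul_le_of_le_one_right hN0.le ht.2)
  refine ⟨⌊N * t⌋₊, Finset.mem_range.2 (Nat.lt_succ_of_le (by exact_mod_cast h3)),
    ⟨by positivity, (div_le_one hN0).2 h3⟩, ?_⟩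
  have e : t - ⌊N * t⌋₊ / N = (N * t - ⌊N * t⌋₊) / N := by field_simp
  rw [e, abs_of_nonneg (div_nonneg (by linarith) hN0.le)]
  gcongr
  linarith

lemma memLp_truncPow (q : ℕ) (v : ℝ) : MemLp (truncPow q v) 2 unitMeasure := by
  refine MemLp.of_bound (measurable_truncPow q v).aestronglyMeasurable ((1 + |v|) ^ (q - 1)) ?_
  filter_upwards [ae_unitMeasure_mem_Ico] with u hu
  exact abs_truncPow_le q v (Ico_subset_Icc_self hu)

lemma coveringNumber_truncPowClass_le {q N : ℕ} (hN : 0 < N) {ε : ℝ} (hε : 0 ≤ ε)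
    (h : ∀ v ∈ Icc (0 : ℝ) 1, ∀ w ∈ Icc (0 : ℝ) 1, |v - w| ≤ 1 / N →
      ∫ u, (truncPow q v u - truncPow q w u) ^ 2 ∂unitMeasure ≤ (ε / 2) ^ 2) :
    (Metric.coveringNumber ε.toNNReal (truncPowClass q) : ℝ≥0∞) ≤ ENNReal.ofReal (N + 1) := by
  classical
  set S : Finset (Lp ℝ 2 unitMeasure) :=
    (Finset.range (N + 1)).image fun i : ℕ =>
      (memLp_truncPow q ((i : ℝ) / N)).toLp _ with hS
  have h1 : Metric.coveringNumber ε.toNNReal (truncPowClass q) ≤ (S.card : ℕ∞) := by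
    refine coveringNumber_le_of_finset hε ?_
    rintro f ⟨v, hv, hf⟩
    obtain ⟨i, hi, hi1, hvi⟩ := exists_grid_point hN hv
    refine ⟨_, Finset.mem_image_of_mem _ hi, ?_⟩
    rw [dist_eq_norm]
    refine (sq_le_sq₀ (norm_nonneg _) (by positivity)).1 ?_
    refine (norm_sq_eq_integral _ ?_).le.trans (h v hv _ hi1 hvi)
    filter_upwards [Lp.coeFn_sub f ((memLp_truncPow q ((i : ℝ) / N)).toLp _), hf,
      (memLp_truncPow q ((i : ℝ) / N)).coeFn_toLp] with u h1 h2 h3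
    rw [h1, Pi.sub_apply, h2, h3]
  calc (Metric.coveringNumber ε.toNNReal (truncPowClass q) : ℝ≥0∞)
      ≤ ((S.card : ℕ∞) : ℝ≥0∞) := ENat.toENNReal_mono h1
    _ = ((S.card : ℕ) : ℝ≥0∞) := by simp
    _ ≤ ((N + 1 : ℕ) : ℝ≥0∞) := by
        exact_mod_cast Finset.card_image_le.trans (Finset.card_range _).le
    _ = _ := by rw [← ENNReal.ofReal_natCast]; push_cast; rfl

lemma coveringNumber_truncPowClass_of_two_le {q : ℕ} (hq : 2 ≤ q) :
    ∃ C : ℝ, ∀ᶠ ε : ℝ in 𝓝[>] 0,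
      (Metric.coveringNumber ε.toNNReal (truncPowClass q) : ℝ≥0∞) ≤
        ENNReal.ofReal (C * (1 / ε)) := by
  refine ⟨2 * q + 2, ?_⟩
  filter_upwards [Ioo_mem_nhdsGT (show (0 : ℝ) < 1 by norm_num)] with ε hε
  have hq0 : (0 : ℝ) < q := by exact_mod_cast (by omega : 0 < q)
  have hε0 := hε.1
  have hpos : 0 < 2 * q / ε := by positivity
  refine (coveringNumber_truncPowClass_le (N := ⌈2 * q / ε⌉₊) (Nat.ceil_pos.2 hpos) hε.1.le
    fun v hv w hw hvw => ?_).trans (ENNReal.ofReal_le_ofReal ?_)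
  · refine (integral_truncPow_sub_sq_le_sq hq hv hw).trans ?_
    refine pow_le_pow_left₀ (by positivity) ?_ 2
    have h1 : |v - w| ≤ ε / (2 * q) := by
      refine hvw.trans ?_
      rw [← one_div_div (2 * (q : ℝ)) ε]
      exact one_div_le_one_div_of_le hpos (Nat.le_ceil _)
    calc q * |v - w| ≤ q * (ε / (2 * q)) := by gcongr
      _ = ε / 2 := by field_simp
  · have h1 := Nat.ceil_lt_add_one hpos.le
    have h2 : 1 ≤ 1 / ε := by rw [le_div_iff₀ hε0]; linarith [hε.2]
    have h3 : (2 * (q : ℝ) + 2) * (1 / ε) = 2 * q / ε + 2 * (1 / ε) := by ring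
    linarith

lemma coveringNumber_truncPowClass_one :
    ∃ C : ℝ, ∀ᶠ ε : ℝ in 𝓝[>] 0,
      (Metric.coveringNumber ε.toNNReal (truncPowClass 1) : ℝ≥0∞) ≤
        ENNReal.ofReal (C * (1 / ε) ^ 2) := by
  refine ⟨6, ?_⟩
  filter_upwards [Ioo_mem_nhdsGT (show (0 : ℝ) < 1 by norm_num)] with ε hε
  have hε0 := hε.1
  have hpos : 0 < 4 / ε ^ 2 := by positivity
  refine (coveringNumber_truncPowClass_le (N := ⌈4 / ε ^ 2⌉₊) (Nat.ceil_pos.2 hpos) hε.1.le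
    fun v hv w hw hvw => ?_).trans (ENNReal.ofReal_le_ofReal ?_)
  · refine (integral_truncPow_sub_sq_le le_rfl hv hw).trans ?_
    rw [Nat.cast_one, one_mul]
    refine hvw.trans ?_
    rw [div_pow, ← one_div_div (2 ^ 2) (ε ^ 2)]
    refine one_div_le_one_div_of_le (by positivity) (le_trans (by norm_num) (Nat.le_ceil _))
  · have h1 := Nat.ceil_lt_add_one hpos.le
    have h2 : 1 ≤ (1 / ε) ^ 2 := by
      refine one_le_pow₀ ?_
      rw [le_div_iff₀ hε0]; linarith [hε.2]
    have h3 : 4 / ε ^ 2 = 4 * (1 / ε) ^ 2 := by ring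
    linarith

lemma abs_prod_sub_prod_le {ι : Type*} (s : Finset ι) (a b : ι → ℝ) (ha : ∀ i ∈ s, |a i| ≤ 1)
    (hb : ∀ i ∈ s, |b i| ≤ 1) : |∏ i ∈ s, a i - ∏ i ∈ s, b i| ≤ ∑ i ∈ s, |a i - b i| := by
  classical
  induction s using Finset.induction_on with
  | empty => simp
  | insert i s hi ih =>
    rw [Finset.prod_insert hi, Finset.prod_insert hi, Finset.sum_insert hi]
    have h1 := ih (fun j hj => ha j (Finset.mem_insert_of_mem hj))
      fun j hj => hb j (Finset.mem_insert_of_mem hj)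
    have h2 : |∏ j ∈ s, a j| ≤ 1 := by
      rw [Finset.abs_prod]
      exact Finset.prod_le_one (fun _ _ => abs_nonneg _)
        fun j hj => ha j (Finset.mem_insert_of_mem hj)
    have h3 := hb i (Finset.mem_insert_self i s)
    have e : a i * ∏ j ∈ s, a j - b i * ∏ j ∈ s, b j =
        (a i - b i) * ∏ j ∈ s, a j + b i * (∏ j ∈ s, a j - ∏ j ∈ s, b j) := by ring
    rw [e]
    refine (abs_add_le _ _).trans (add_le_add ?_ ?_)
    · rw [abs_mul]
      exact mul_le_of_le_one_right (abs_nonneg _) h2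
    · rw [abs_mul]
      exact (mul_le_of_le_one_left (abs_nonneg _) h3).trans h1

/-- The factors are exchanged one at a time; Cauchy–Schwarz on the `d` terms costs one `d`, their
sum another. -/
lemma norm_tens_sub_tens_sq_le {q d : ℕ} (hq : 1 ≤ q) {v w : Fin d → ℝ} (hv : v ∈ closedCube d)
    (hw : w ∈ closedCube d) {δ : ℝ} (hδ : ∀ k, |v k - w k| ≤ δ) :
    ‖tens q v - tens q w‖ ^ 2 ≤ d ^ 2 * q * δ := by
  have hint : ∀ k : Fin d, Integrable (fun u : Fin d → ℝ =>
      (truncPow q (v k) (u k) - truncPow q (w k) (u k)) ^ 2) (cubeMeasure d) := fun k =>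
    integrable_comp_eval (μ := fun _ : Fin d => unitMeasure) (i := k)
      (f := fun t => (truncPow q (v k) t - truncPow q (w k) t) ^ 2)
      (integrable_sq_truncPow_sub q (v k) (w k))
  have he : (tens q v - tens q w : L2Cube d) =ᵐ[cubeMeasure d]
      fun u => tensorPow q v u - tensorPow q w u := by
    filter_upwards [Lp.coeFn_sub (tens q v) (tens q w), coeFn_tens q v, coeFn_tens q w]
      with u h1 h2 h3
    rw [h1, Pi.sub_apply, h2, h3]
  rw [norm_sq_eq_integral _ he]
  calc ∫ u, (tensorPow q v u - tensorPow q w u) ^ 2 ∂cubeMeasure d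
      ≤ ∫ u, d * ∑ k, (truncPow q (v k) (u k) - truncPow q (w k) (u k)) ^ 2 ∂cubeMeasure d := by
        refine integral_mono_ae ?_ ((integrable_finsetSum _ fun k _ => hint k).const_mul _) ?_
        · exact ((memLp_tensorPow q v).sub (memLp_tensorPow q w)).integrable_sq
        · filter_upwards [ae_cubeMeasure_mem_Ico d] with u hu
          have h1 := abs_prod_sub_prod_le Finset.univ (fun k => truncPow q (v k) (u k))
            (fun k => truncPow q (w k) (u k))
            (fun k _ => abs_truncPow_le_one q (hv k) (Ico_subset_Icc_self (hu k)))
            (fun k _ => abs_truncPow_le_one q (hw k) (Ico_subset_Icc_self (hu k)))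
          have h2 := sq_sum_le_card_mul_sum_sq (s := Finset.univ)
            (f := fun k => |truncPow q (v k) (u k) - truncPow q (w k) (u k)|)
          rw [← sq_abs]
          refine (pow_le_pow_left₀ (abs_nonneg _) h1 2).trans (h2.trans (le_of_eq ?_))
          simp
    _ = d * ∑ k, ∫ u, (truncPow q (v k) u - truncPow q (w k) u) ^ 2 ∂unitMeasure := by
        rw [integral_const_mul, integral_finsetSum _ fun k _ => hint k]
        congr 1
        refine Finset.sum_congr rfl fun k _ => ?_
        exact integral_comp_eval (μ := fun _ : Fin d => unitMeasure)
          (integrable_sq_truncPow_sub q (v k) (w k)).aestronglyMeasurable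
    _ ≤ d * ∑ _k : Fin d, q * δ := by
        gcongr with k
        exact (integral_truncPow_sub_sq_le hq (hv k) (hw k)).trans (by gcongr; exact hδ k)
    _ = _ := by simp; ring

/-- Nets of the signed tensors of exponential size. -/
lemma exists_net_signedTensors {q : ℕ} (hq : 1 ≤ q) (d n : ℕ) :
    ∃ Y : Finset (L2Cube d), Y.card ≤ 2 ^ ((2 * q * d + d ^ 3 * q + d + 1) * (n + 1)) ∧
      ∀ z ∈ signedTensors q d, ∃ y ∈ Y, ‖z - y‖ ≤ 1 / 2 ^ (n * q) := by
  classical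
  -- The mesh `2 ^ (-m)` makes the squared error at most `d ^ 2 * q * 2 ^ (-m) ≤ 2 ^ (-2 * n * q)`,
  -- as `d ^ 2 * q ≤ 2 ^ (d ^ 2 * q)`.
  set m := 2 * (n * q) + d ^ 2 * q with hm
  set S : Finset (L2Cube d) := (Fintype.piFinset fun _ : Fin d => Finset.range (2 ^ m + 1)).image
    fun i => tens q fun k => (i k : ℝ) / (2 ^ m : ℕ) with hS
  have hSc : S.card ≤ 2 ^ ((m + 1) * d) := by
    refine Finset.card_image_le.trans ?_
    rw [Fintype.card_piFinset]
    simp only [Finset.card_range, Finset.prod_const, Finset.card_univ, Fintype.card_fin]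
    rw [pow_mul]
    refine Nat.pow_le_pow_left ?_ d
    rw [pow_succ]
    have := Nat.one_le_two_pow (n := m)
    omega
  have hSn : ∀ v ∈ closedCube d, ∃ y ∈ S, ‖tens q v - y‖ ≤ 1 / 2 ^ (n * q) := by
    intro v hv
    choose i hi hi1 hvi using fun k => exists_grid_point (N := 2 ^ m) (by positivity) (hv k)
    refine ⟨tens q fun k => (i k : ℝ) / (2 ^ m : ℕ),
      Finset.mem_image.2 ⟨i, Fintype.mem_piFinset.2 hi, rfl⟩, ?_⟩
    refine (sq_le_sq₀ (norm_nonneg _) (by positivity)).1 ?_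
    refine (norm_tens_sub_tens_sq_le hq hv hi1 hvi).trans ?_
    push_cast
    rw [mul_one_div, div_pow, one_pow, ← pow_mul, div_le_div_iff₀ (by positivity) (by positivity),
      one_mul, hm, pow_add, mul_comm (n * q) 2, mul_comm ((2 : ℝ) ^ (2 * (n * q)))]
    gcongr
    exact_mod_cast (Nat.lt_two_pow_self (n := d ^ 2 * q)).le
  refine ⟨S ∪ S.image fun y => -y, ?_, ?_⟩
  · calc (S ∪ S.image fun y => -y).card ≤ S.card + S.card :=
          (Finset.card_union_le _ _).trans (Nat.add_le_add_left Finset.card_image_le _)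
      _ ≤ 2 ^ ((m + 1) * d) + 2 ^ ((m + 1) * d) := by gcongr
      _ = 2 ^ ((m + 1) * d + 1) := by rw [pow_succ]; ring
      _ ≤ _ := by
          refine Nat.pow_le_pow_right (by norm_num) ?_
          have e : (2 * q * d + d ^ 3 * q + d + 1) * (n + 1) =
            ((m + 1) * d + 1) + (2 * q * d + d ^ 3 * q * n + d * n + n) := by
            rw [hm]; ring
          rw [e]
          exact Nat.le_add_right _ _
  · rintro z (⟨v, hv, rfl⟩ | ⟨v, hv, rfl⟩)
    · obtain ⟨y, hy, h⟩ := hSn v hv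
      exact ⟨y, Finset.mem_union_left _ hy, h⟩
    · obtain ⟨y, hy, h⟩ := hSn v hv
      refine ⟨-y, Finset.mem_union_right _ (Finset.mem_image_of_mem _ hy), ?_⟩
      rwa [← neg_sub', norm_neg]

end Nets

/-- Dyadic covers of the absolutely convex hull of the tensors. -/
lemma hasDyadicCovers_absconvTensor {q d : ℕ} (hq : 1 ≤ q) (hd : 1 ≤ d) :
    HasDyadicCovers q (d - 1) (absconvTensor q d) := by
  obtain ⟨D, rfl⟩ := Nat.exists_eq_add_of_le' hd
  rw [Nat.add_sub_cancel]
  rw [absconvTensor_eq]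
  -- The first summand bounds the dimension and the approximation constant `2 ^ (D + 1)`, the second
  -- the net exponent.
  set A := 2 ^ (2 * D + 2) * q ^ (D + 1) +
    (2 * q * (D + 1) + (D + 1) ^ 3 * q + (D + 1) + 1) with hA
  refine (hasDyadicCovers_convexHull q D A hq ?_ ?_ ?_).closure
  · rintro _ (⟨v, hv, rfl⟩ | ⟨v, hv, rfl⟩)
    · exact norm_tens_le_one q hv
    · simpa using norm_tens_le_one q hv
  · intro n
    have hfd : FiniteDimensional ℝ (hyperbolicCross q (D + 1) n) :=
      FiniteDimensional.span_of_finite ℝ (Set.finite_range _)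
    refine ⟨hyperbolicCross q (D + 1) n, hfd, ?_, ?_⟩
    · refine (finrank_range_le_card _).trans ?_
      rw [Fintype.card_coe]
      refine (card_monomialIndex_le q D n).trans (Nat.mul_le_mul_right _ (Nat.le_add_right _ _))
    · have hle : ∀ v ∈ closedCube (D + 1), ∃ g ∈ hyperbolicCross q (D + 1) n,
          ‖tens q v - g‖ ^ 2 ≤ A * (n + 1) ^ D / 2 ^ (n * (2 * q - 1)) := by
        intro v hv
        obtain ⟨g, hg, h⟩ := exists_mem_hyperbolicCross_norm_sub_le hq D n hv
        refine ⟨g, hg, h.trans ?_⟩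
        gcongr
        have : 2 ^ (D + 1) ≤ A := by
          refine le_trans ?_ (Nat.le_add_right _ _)
          calc 2 ^ (D + 1) ≤ 2 ^ (2 * D + 2) := Nat.pow_le_pow_right (by norm_num) (by omega)
            _ ≤ _ := Nat.le_mul_of_pos_right _ (by positivity)
        exact_mod_cast this
      rintro _ (⟨v, hv, rfl⟩ | ⟨v, hv, rfl⟩)
      · exact hle v hv
      · obtain ⟨g, hg, h⟩ := hle v hv
        refine ⟨-g, Submodule.neg_mem _ hg, ?_⟩
        rwa [← neg_sub', norm_neg]
  · intro n
    obtain ⟨Y, hY, h⟩ := exists_net_signedTensors hq (D + 1) n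
    exact ⟨Y, hY.trans (Nat.pow_le_pow_right (by norm_num)
      (Nat.mul_le_mul_right _ (Nat.le_add_left _ _))), h⟩

/-! ### Truncated powers as fundamental solutions -/

section OneVariable

lemma tsupport_iterate_deriv_subset (n : ℕ) (h : ℝ → ℝ) : tsupport (deriv^[n] h) ⊆ tsupport h := by
  induction n generalizing h with
  | zero => exact subset_rfl
  | succ n ih => exact (ih (deriv h)).trans tsupport_deriv_subset

/-- Repeated integration by parts: the boundary terms vanish at `1` by the support of `h` and at `v`
by the power of `u - v`, until the last step leaves `-h v`. -/
lemma integral_sub_pow_mul_iterate_deriv {h : ℝ → ℝ} (hh : ContDiff ℝ (⊤ : ℕ∞) h)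
    (hs : tsupport h ⊆ Ioo 0 1) (v : ℝ) (m : ℕ) :
    ∫ u in v..1, (u - v) ^ m * (deriv^[m + 1] h) u = (-1) ^ (m + 1) * m.factorial * h v := by
  have h1 : ∀ n, (deriv^[n] h) 1 = 0 := fun n =>
    image_eq_zero_of_notMem_tsupport fun hc =>
      lt_irrefl (1 : ℝ) (hs (tsupport_iterate_deriv_subset n h hc)).2
  have hd : ∀ n x, HasDerivAt (deriv^[n] h) ((deriv^[n + 1] h) x) x := fun n x => by
    rw [Function.iterate_succ_apply']
    exact ((hh.iterate_deriv n).differentiable (by simp) x).hasDerivAt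
  have hcont : ∀ n, Continuous (deriv^[n] h) := fun n => (hh.iterate_deriv n).continuous
  induction m with
  | zero =>
    simp only [pow_zero, one_mul]
    rw [intervalIntegral.integral_eq_sub_of_hasDerivAt (fun x _ => hd 0 x)
      ((hcont _).intervalIntegrable _ _), h1]
    simp
  | succ m ih =>
    have hp : ∀ x, HasDerivAt (fun u => (u - v) ^ (m + 1)) ((m + 1 : ℕ) * (x - v) ^ m) x :=
      fun x => by simpa using ((hasDerivAt_id x).sub_const v).fun_pow (m + 1)
    rw [intervalIntegral.integral_mul_deriv_eq_deriv_mul (fun x _ => hp x)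
      (fun x _ => hd (m + 1) x) (Continuous.intervalIntegrable (by fun_prop) _ _)
      ((hcont _).intervalIntegrable _ _), h1]
    simp only [mul_assoc, intervalIntegral.integral_const_mul, ih]
    rw [Nat.factorial_succ]
    push_cast
    simp
    ring

/-- Truncated powers are fundamental solutions of iterated derivatives. -/
lemma integral_truncPow_mul_iterate_deriv {q : ℕ} (hq : 1 ≤ q) {h : ℝ → ℝ}
    (hh : ContDiff ℝ (⊤ : ℕ∞) h) (hs : tsupport h ⊆ Ioo 0 1) {v : ℝ} (hv : v ∈ Icc (0 : ℝ) 1) :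
    ∫ u, truncPow q v u * (deriv^[q] h) u ∂unitMeasure =
      (-1) ^ q * (q - 1).factorial * h v := by
  obtain ⟨m, rfl⟩ := Nat.exists_eq_add_of_le' hq
  rw [Nat.add_sub_cancel, ← integral_sub_pow_mul_iterate_deriv hh hs v m,
    intervalIntegral.integral_of_le hv.2, ← integral_Icc_eq_integral_Ioc]
  have e : (fun u => truncPow (m + 1) v u * (deriv^[m + 1] h) u) =
      (Ici v).indicator fun u => (u - v) ^ m * (deriv^[m + 1] h) u := by
    funext u
    by_cases hu : v ≤ u
    · rw [indicator_of_mem (show u ∈ Ici v from hu), truncPow, if_pos hu, Nat.add_sub_cancel]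
    · rw [indicator_of_notMem (show u ∉ Ici v from hu), truncPow, if_neg hu, zero_mul]
  rw [e, integral_indicator measurableSet_Ici, Measure.restrict_restrict measurableSet_Ici]
  congr 2
  ext u
  simp only [mem_inter_iff, mem_Ici, mem_Icc]
  exact ⟨fun h => ⟨h.1, h.2.2⟩, fun h => ⟨h.1, hv.1.trans h.1, h.2⟩⟩

end OneVariable

/-! ### The mixed derivative, one coordinate at a time -/

section MixedDerivatives

variable {d : ℕ}

lemma partialDeriv_eq_fderiv (k : Fin d) {φ : (Fin d → ℝ) → ℝ} (h : ContDiff ℝ (⊤ : ℕ∞) φ) :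
    partialDeriv k φ = fun u => fderiv ℝ φ u (Pi.single k 1) :=
  funext fun u => ((h.differentiable (by simp)) u).lineDeriv_eq_fderiv

/-- The composition of the operators `∂_k ^ q` over a list of coordinates. -/
noncomputable def mixedDerivList (q : ℕ) (l : List (Fin d)) (φ : (Fin d → ℝ) → ℝ) :
    (Fin d → ℝ) → ℝ :=
  l.foldr (fun k g => (partialDeriv k)^[q] g) φ

lemma contDiff_iterate_partialDeriv (k : Fin d) (n : ℕ) {φ : (Fin d → ℝ) → ℝ}
    (h : ContDiff ℝ (⊤ : ℕ∞) φ) : ContDiff ℝ (⊤ : ℕ∞) ((partialDeriv k)^[n] φ) := by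
  induction n generalizing φ with
  | zero => exact h
  | succ n ih => exact ih (contDiff_partialDeriv k h)

lemma contDiff_mixedDerivList (q : ℕ) (l : List (Fin d)) {φ : (Fin d → ℝ) → ℝ}
    (h : ContDiff ℝ (⊤ : ℕ∞) φ) : ContDiff ℝ (⊤ : ℕ∞) (mixedDerivList q l φ) := by
  induction l with
  | nil => exact h
  | cons k l ih => exact contDiff_iterate_partialDeriv k q ih

lemma tsupport_mixedDerivList_subset (q : ℕ) (l : List (Fin d)) {φ : (Fin d → ℝ) → ℝ}
    (h : ContDiff ℝ (⊤ : ℕ∞) φ) : tsupport (mixedDerivList q l φ) ⊆ tsupport φ := by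
  have key : ∀ (k : Fin d) (n : ℕ) (g : (Fin d → ℝ) → ℝ), ContDiff ℝ (⊤ : ℕ∞) g →
      tsupport ((partialDeriv k)^[n] g) ⊆ tsupport g := by
    intro k n
    induction n with
    | zero => exact fun g _ => subset_rfl
    | succ n ih =>
      intro g hg
      refine (ih _ (contDiff_partialDeriv k hg)).trans ?_
      rw [partialDeriv_eq_fderiv k hg]
      exact tsupport_fderiv_apply_subset ℝ _
  induction l with
  | nil => exact subset_rfl
  | cons k l ih => exact (key k q _ (contDiff_mixedDerivList q l h)).trans ih

lemma mixedDeriv_linear (q : ℕ) {φ ψ : (Fin d → ℝ) → ℝ} (hφ : ContDiff ℝ (⊤ : ℕ∞) φ)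
    (hψ : ContDiff ℝ (⊤ : ℕ∞) ψ) (a b : ℝ) :
    mixedDeriv q d (a • φ + b • ψ) = a • mixedDeriv q d φ + b • mixedDeriv q d ψ := by
  have h1 : ∀ (k : Fin d) {φ ψ : (Fin d → ℝ) → ℝ}, ContDiff ℝ (⊤ : ℕ∞) φ →
      ContDiff ℝ (⊤ : ℕ∞) ψ →
      partialDeriv k (a • φ + b • ψ) = a • partialDeriv k φ + b • partialDeriv k ψ := by
    intro k φ ψ hφ hψ
    have hφ' := hφ.differentiable (by simp)
    have hψ' := hψ.differentiable (by simp)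
    have hs : ContDiff ℝ (⊤ : ℕ∞) (a • φ + b • ψ) := (hφ.const_smul a).add (hψ.const_smul b)
    rw [partialDeriv_eq_fderiv k hφ, partialDeriv_eq_fderiv k hψ, partialDeriv_eq_fderiv k hs]
    funext u
    rw [fderiv_add ((hφ' u).const_smul a) ((hψ' u).const_smul b), fderiv_const_smul (hφ' u),
      fderiv_const_smul (hψ' u)]
    rfl
  have h2 : ∀ (k : Fin d) (n : ℕ) {φ ψ : (Fin d → ℝ) → ℝ}, ContDiff ℝ (⊤ : ℕ∞) φ →
      ContDiff ℝ (⊤ : ℕ∞) ψ → (partialDeriv k)^[n] (a • φ + b • ψ) =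
        a • (partialDeriv k)^[n] φ + b • (partialDeriv k)^[n] ψ := by
    intro k n
    induction n with
    | zero => exact fun _ _ => rfl
    | succ n ih =>
      intro φ ψ hφ hψ
      rw [Function.iterate_succ_apply, h1 k hφ hψ,
        ih (contDiff_partialDeriv k hφ) (contDiff_partialDeriv k hψ)]
      rfl
  have h3 : ∀ l : List (Fin d), mixedDerivList q l (a • φ + b • ψ) =
      a • mixedDerivList q l φ + b • mixedDerivList q l ψ := by
    intro l
    induction l with
    | nil => rfl
    | cons k l ih =>
      change (partialDeriv k)^[q] (mixedDerivList q l (a • φ + b • ψ)) = _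
      rw [ih, h2 k q (contDiff_mixedDerivList q l hφ) (contDiff_mixedDerivList q l hψ)]
      rfl
  exact h3 _

/-- A line in direction `k.succ` stays in the slice, so slicing intertwines the two operators and
hence their iterates. -/
lemma iterate_partialDeriv_succ_cons (k : Fin d) (n : ℕ) (φ : (Fin (d + 1) → ℝ) → ℝ) (x : ℝ) :
    (fun w => ((partialDeriv k.succ)^[n] φ) (Fin.cons x w : Fin (d + 1) → ℝ)) =
      (partialDeriv k)^[n] fun w => φ (Fin.cons x w : Fin (d + 1) → ℝ) := by
  have h : Function.Semiconj
      (fun (φ : (Fin (d + 1) → ℝ) → ℝ) (w : Fin d → ℝ) => φ (Fin.cons x w : Fin (d + 1) → ℝ))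
      (partialDeriv k.succ) (partialDeriv k) := by
    intro φ
    funext w
    have e : ∀ t : ℝ, (Fin.cons x w : Fin (d + 1) → ℝ) + t • Pi.single k.succ 1 =
        (Fin.cons x (w + t • Pi.single k 1) : Fin (d + 1) → ℝ) := fun t => by
      funext i
      refine Fin.cases ?_ (fun j => ?_) i
      · simp
      · simp [Pi.single_apply]
    simp only [partialDeriv, lineDeriv, e]
  exact h.iterate_right n φ

lemma iterate_partialDeriv_zero_cons (n : ℕ) (φ : (Fin (d + 1) → ℝ) → ℝ) (w : Fin d → ℝ) :
    (fun x => ((partialDeriv 0)^[n] φ) (Fin.cons x w : Fin (d + 1) → ℝ)) =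
      deriv^[n] fun x => φ (Fin.cons x w : Fin (d + 1) → ℝ) := by
  have h : Function.Semiconj
      (fun (φ : (Fin (d + 1) → ℝ) → ℝ) (x : ℝ) => φ (Fin.cons x w : Fin (d + 1) → ℝ))
      (partialDeriv 0) deriv := by
    intro φ
    funext x
    have e : ∀ t : ℝ, (Fin.cons x w : Fin (d + 1) → ℝ) + t • Pi.single 0 1 =
        (Fin.cons (x + t) w : Fin (d + 1) → ℝ) := fun t => by
      funext i
      refine Fin.cases ?_ (fun j => ?_) i
      · simp
      · simp
    simp only [partialDeriv, lineDeriv, e]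
    rw [deriv_comp_const_add (f := fun y => φ (Fin.cons y w : Fin (d + 1) → ℝ)), add_zero]
  exact h.iterate_right n φ

lemma mixedDerivList_map_succ_cons (q : ℕ) (l : List (Fin d)) (φ : (Fin (d + 1) → ℝ) → ℝ)
    (x : ℝ) :
    (fun w => mixedDerivList q (l.map Fin.succ) φ (Fin.cons x w : Fin (d + 1) → ℝ)) =
      mixedDerivList q l fun w => φ (Fin.cons x w : Fin (d + 1) → ℝ) := by
  induction l with
  | nil => rfl
  | cons k l ih =>
    exact (iterate_partialDeriv_succ_cons k q _ x).trans (congrArg _ ih)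

lemma mixedDeriv_succ_cons (q : ℕ) (φ : (Fin (d + 1) → ℝ) → ℝ) (w : Fin d → ℝ) :
    (fun x => mixedDeriv q (d + 1) φ (Fin.cons x w : Fin (d + 1) → ℝ)) =
      deriv^[q] fun x => mixedDerivList q ((List.finRange d).map Fin.succ) φ
        (Fin.cons x w : Fin (d + 1) → ℝ) := by
  rw [← iterate_partialDeriv_zero_cons, mixedDeriv, List.finRange_succ]
  rfl

lemma integrable_mul_continuous {f g : (Fin d → ℝ) → ℝ} (hf : Integrable f (cubeMeasure d))
    (hg : Continuous g) : Integrable (fun u => f u * g u) (cubeMeasure d) := by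
  obtain ⟨C, hC⟩ := (isCompact_univ_pi fun _ : Fin d =>
    isCompact_Icc (a := (0 : ℝ)) (b := 1)).exists_bound_of_continuousOn hg.continuousOn
  refine hf.mul_bdd (c := C) hg.aestronglyMeasurable ?_
  filter_upwards [ae_cubeMeasure_mem_Ico d] with u hu
  exact hC u fun k _ => Ico_subset_Icc_self (hu k)

lemma memLp_of_continuous {g : (Fin d → ℝ) → ℝ} (hg : Continuous g) :
    MemLp g 2 (cubeMeasure d) := by
  obtain ⟨C, hC⟩ := (isCompact_univ_pi fun _ : Fin d =>
    isCompact_Icc (a := (0 : ℝ)) (b := 1)).exists_bound_of_continuousOn hg.continuousOn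
  refine MemLp.of_bound hg.aestronglyMeasurable C ?_
  filter_upwards [ae_cubeMeasure_mem_Ico d] with u hu
  exact hC u fun k _ => Ico_subset_Icc_self (hu k)

lemma contDiff_cons_left (w : Fin d → ℝ) :
    ContDiff ℝ (⊤ : ℕ∞) fun x : ℝ => (Fin.cons x w : Fin (d + 1) → ℝ) := by
  refine contDiff_pi.2 fun i => ?_
  refine Fin.cases ?_ (fun j => ?_) i
  · simp only [Fin.cons_zero]
    exact contDiff_id
  · simpa using contDiff_const

lemma contDiff_cons_right (x : ℝ) :
    ContDiff ℝ (⊤ : ℕ∞) fun w : Fin d → ℝ => (Fin.cons x w : Fin (d + 1) → ℝ) := by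
  refine contDiff_pi.2 fun i => ?_
  refine Fin.cases ?_ (fun j => ?_) i
  · simpa using contDiff_const
  · simpa using contDiff_apply ℝ ℝ j

/-- The tensors of truncated powers are fundamental solutions of the mixed derivative. -/
lemma integral_tensorPow_mul_mixedDeriv {q : ℕ} (hq : 1 ≤ q) {φ : (Fin d → ℝ) → ℝ}
    (hφ : ContDiff ℝ (⊤ : ℕ∞) φ) (hs : tsupport φ ⊆ openCube d) {v : Fin d → ℝ}
    (hv : v ∈ closedCube d) :
    ∫ u, tensorPow q v u * mixedDeriv q d φ u ∂cubeMeasure d =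
      ((-1) ^ q * (q - 1).factorial) ^ d * φ v := by
  induction d with
  | zero =>
    rw [integral_unique]
    simp only [tensorPow, mixedDeriv, Finset.univ_eq_empty, Finset.prod_empty, one_mul, pow_zero,
      List.finRange_zero, List.foldr_nil, probReal_univ, smul_eq_mul]
    exact congrArg φ (Subsingleton.elim _ _)
  | succ d ih =>
    set c : ℝ := (-1) ^ q * (q - 1).factorial with hc
    set T := (MeasurableEquiv.piFinSuccAbove (fun _ : Fin (d + 1) => ℝ) 0).symm with hT
    have hTm : MeasurePreserving T (unitMeasure.prod (cubeMeasure d)) (cubeMeasure (d + 1)) :=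
      (measurePreserving_piFinSuccAbove (fun _ : Fin (d + 1) => unitMeasure) 0).symm
    have hTa : ∀ p : ℝ × (Fin d → ℝ), T p = (Fin.cons p.1 p.2 : Fin (d + 1) → ℝ) := fun p =>
      Fin.insertNth_zero' p.1 p.2
    have hint : Integrable (fun u => tensorPow q v u * mixedDeriv q (d + 1) φ u)
        (cubeMeasure (d + 1)) :=
      integrable_mul_continuous ((memLp_tensorPow q v).integrable (by norm_num))
        (contDiff_mixedDeriv q (d + 1) hφ).continuous
    have hint' := (hTm.integrable_comp_emb T.measurableEmbedding).2 hint
    rw [← hTm.integral_comp T.measurableEmbedding]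
    have hprod := integral_prod_symm _ hint'
    simp only [Function.comp_apply] at hprod
    rw [hprod]
    set g := mixedDerivList q ((List.finRange d).map Fin.succ) φ with hg
    have hg1 : ContDiff ℝ (⊤ : ℕ∞) g := contDiff_mixedDerivList q _ hφ
    have hg2 : tsupport g ⊆ openCube (d + 1) := (tsupport_mixedDerivList_subset q _ hφ).trans hs
    -- Coordinate `0` is differentiated last, so it can be integrated out first; this freezes it at
    -- `v 0` and leaves the mixed derivative of the slice.
    have hinner : ∀ w : Fin d → ℝ,
        ∫ x, tensorPow q v (T (x, w)) * mixedDeriv q (d + 1) φ (T (x, w)) ∂unitMeasure =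
          c * (tensorPow q (Fin.tail v) w *
            mixedDeriv q d (fun w => φ (Fin.cons (v 0) w : Fin (d + 1) → ℝ)) w) := by
      intro w
      have e : ∀ x, tensorPow q v (T (x, w)) * mixedDeriv q (d + 1) φ (T (x, w)) =
          tensorPow q (Fin.tail v) w * (truncPow q (v 0) x *
            (deriv^[q] fun x => g (Fin.cons x w : Fin (d + 1) → ℝ)) x) := by
        intro x
        rw [← mixedDeriv_succ_cons, hTa, tensorPow, Fin.prod_univ_succ]
        simp only [Fin.cons_zero, Fin.cons_succ, tensorPow, Fin.tail]
        ring
      simp only [e]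
      rw [integral_const_mul, integral_truncPow_mul_iterate_deriv hq
        (h := fun x => g (Fin.cons x w : Fin (d + 1) → ℝ))
        (hg1.comp (contDiff_cons_left w)) ?_ (hv 0)]
      · have h1 : g (Fin.cons (v 0) w : Fin (d + 1) → ℝ) =
            mixedDeriv q d (fun w => φ (Fin.cons (v 0) w : Fin (d + 1) → ℝ)) w :=
          congrFun (mixedDerivList_map_succ_cons q (List.finRange d) φ (v 0)) w
        rw [h1]
        ring
      · intro x hx
        have h1 := hg2 (tsupport_comp_subset_preimage g (contDiff_cons_left w).continuous hx)
        simpa using h1 0 (mem_univ _)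
    simp only [hinner]
    rw [integral_const_mul,
      ih (φ := fun w => φ (Fin.cons (v 0) w : Fin (d + 1) → ℝ)) (v := Fin.tail v)
        (hφ.comp (contDiff_cons_right (v 0))) ?_ fun k => hv k.succ]
    · rw [Fin.cons_self_tail, pow_succ]
      ring
    · intro w hw
      have h1 := hs (tsupport_comp_subset_preimage φ (contDiff_cons_right (v 0)).continuous hw)
      intro k _
      simpa using h1 k.succ (mem_univ _)

end MixedDerivatives

/-! ### Orthogonal projections and separation -/

section Projection

variable {H : Type*} [NormedAddCommGroup H] [InnerProductSpace ℝ H]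

lemma lipschitzWith_starProjection (K : Submodule ℝ H) [K.HasOrthogonalProjection] :
    LipschitzWith 1 K.starProjection :=
  LipschitzWith.of_dist_le_mul fun x y => by
    rw [dist_eq_norm, dist_eq_norm, ← map_sub, NNReal.coe_one, one_mul]
    exact K.norm_starProjection_apply_le _

lemma inner_starProjection_of_mem {K : Submodule ℝ H} [K.HasOrthogonalProjection] {x : H}
    (hx : x ∈ K) (y : H) : inner ℝ x (K.starProjection y) = inner ℝ x y := by
  rw [← Submodule.inner_starProjection_left_eq_right, Submodule.starProjection_eq_self_iff.2 hx]

lemma hasOrthogonalProjection_orthogonal [CompleteSpace H] (K : Submodule ℝ H) :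
    Kᗮ.HasOrthogonalProjection := inferInstance

/-- Separation of a point of a subspace from the projection of a compact convex set. -/
lemma exists_separating_of_notMem_image_starProjection [CompleteSpace H] {K : Submodule ℝ H}
    [K.HasOrthogonalProjection] {T : Set H} (hT : IsCompact T) (hconv : Convex ℝ T) {f : H}
    (hf : f ∈ K) (hfT : f ∉ K.starProjection '' T) :
    ∃ g : H, ∃ t : ℝ, g ∈ K ∧ (∀ x ∈ T, inner ℝ g x < t) ∧ t < inner ℝ g f := by
  obtain ⟨F, t, hFt, htF⟩ := geometric_hahn_banach_closed_point
    (hconv.linear_image (K.starProjection : H →ₗ[ℝ] H))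
    (hT.image K.starProjection.continuous).isClosed hfT
  -- Projecting the Riesz vector of `F` to `K` does not change its pairing with elements of `K`.
  set g := K.starProjection ((InnerProductSpace.toDual ℝ H).symm F) with hg
  have hgF : ∀ x, inner ℝ g x = F (K.starProjection x) := fun x => by
    rw [hg, Submodule.inner_starProjection_left_eq_right, InnerProductSpace.toDual_symm_apply]
  refine ⟨g, t, Submodule.starProjection_apply_mem _ _, fun x hx => ?_, ?_⟩
  · rw [hgF]; exact hFt _ (mem_image_of_mem _ hx)
  · rw [hgF, Submodule.starProjection_eq_self_iff.2 hf]; exact htF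

end Projection

/-! ### The projected hull as a ball of the Vitali variation -/

section Duality

variable {d : ℕ}

/-- The mixed derivative of test functions, with values in `L²`. -/
noncomputable def mixedDerivL2 (q d : ℕ) : 𝓓(openCube d, ℝ) →ₗ[ℝ] L2Cube d where
  toFun φ := (memLp_of_continuous (contDiff_mixedDeriv q d φ.contDiff).continuous).toLp _
  map_add' φ ψ := by
    rw [← MemLp.toLp_add]
    congr 1
    have := mixedDeriv_linear q φ.contDiff ψ.contDiff 1 1
    simpa using this
  map_smul' c φ := by
    rw [RingHom.id_apply, ← MemLp.toLp_const_smul]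
    congr 1
    have := mixedDeriv_linear q φ.contDiff φ.contDiff c 0
    simpa using this

lemma coeFn_mixedDerivL2 (q : ℕ) (φ : 𝓓(openCube d, ℝ)) :
    mixedDerivL2 q d φ =ᵐ[cubeMeasure d] mixedDeriv q d φ :=
  (memLp_of_continuous (contDiff_mixedDeriv q d φ.contDiff).continuous).coeFn_toLp

lemma inner_mixedDerivL2 (q : ℕ) (φ : 𝓓(openCube d, ℝ)) (f : L2Cube d) :
    inner ℝ (mixedDerivL2 q d φ) f = ∫ u, f u * mixedDeriv q d φ u ∂cubeMeasure d := by
  rw [L2.inner_def]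
  refine integral_congr_ae ?_
  filter_upwards [coeFn_mixedDerivL2 q φ] with u hu
  rw [hu]
  simp

/-- Consequently the orthogonal complement of the null space is the closure of the derivatives of
test functions, which supplies approximating `φ` in the duality argument. -/
lemma nullSpace_eq (q d : ℕ) : nullSpace q d = (LinearMap.range (mixedDerivL2 q d))ᗮ := by
  ext f
  rw [Submodule.mem_orthogonal]
  constructor
  · rintro h _ ⟨φ, rfl⟩
    rw [inner_mixedDerivL2]
    exact h φ
  · intro h φ
    rw [← inner_mixedDerivL2]
    exact h _ ⟨φ, rfl⟩

lemma mixedDerivL2_mem_orthogonal (q : ℕ) (φ : 𝓓(openCube d, ℝ)) :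
    mixedDerivL2 q d φ ∈ (nullSpace q d)ᗮ := by
  rw [nullSpace_eq]
  exact Submodule.le_orthogonal_orthogonal _ ⟨φ, rfl⟩

lemma vitaliVariation_le_iff {q : ℕ} {f : L2Cube d} {r : ℝ} (hr : 0 ≤ r) :
    vitaliVariation q f ≤ ENNReal.ofReal r ↔ ∀ φ : 𝓓(openCube d, ℝ), (∀ u, |φ u| ≤ 1) →
      inner ℝ (mixedDerivL2 q d φ) f ≤ r := by
  simp only [vitaliVariation, iSup_le_iff, ← inner_mixedDerivL2, ENNReal.ofReal_le_ofReal_iff hr]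

lemma inner_mixedDerivL2_tens {q : ℕ} (hq : 1 ≤ q) (φ : 𝓓(openCube d, ℝ)) {v : Fin d → ℝ}
    (hv : v ∈ closedCube d) :
    inner ℝ (mixedDerivL2 q d φ) (tens q v) = ((-1) ^ q * (q - 1).factorial) ^ d * φ v := by
  rw [inner_mixedDerivL2, ← integral_tensorPow_mul_mixedDeriv hq φ.contDiff φ.tsupport_subset hv]
  refine integral_congr_ae ?_
  filter_upwards [coeFn_tens q v] with u hu
  rw [hu]

lemma abs_inner_mixedDerivL2_tens {q : ℕ} (hq : 1 ≤ q) (φ : 𝓓(openCube d, ℝ)) {v : Fin d → ℝ}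
    (hv : v ∈ closedCube d) :
    |inner ℝ (mixedDerivL2 q d φ) (tens q v)| = ((q - 1).factorial : ℝ) ^ d * |φ v| := by
  rw [inner_mixedDerivL2_tens hq φ hv, abs_mul, abs_pow, abs_mul, abs_pow, abs_neg, abs_one,
    one_pow, one_mul, Nat.abs_cast]

/-- The bound holds for the generators, and a closed half-space that contains them contains the
hull. -/
lemma inner_mixedDerivL2_le {q : ℕ} (hq : 1 ≤ q) {φ : 𝓓(openCube d, ℝ)} (hφ : ∀ u, |φ u| ≤ 1)
    {f : L2Cube d} (hf : f ∈ absconvTensor q d) :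
    inner ℝ (mixedDerivL2 q d φ) f ≤ ((q - 1).factorial : ℝ) ^ d := by
  rw [absconvTensor_eq] at hf
  have hb : ∀ v ∈ closedCube d, |inner ℝ (mixedDerivL2 q d φ) (tens q v)| ≤
      ((q - 1).factorial : ℝ) ^ d := fun v hv => by
    rw [abs_inner_mixedDerivL2_tens hq φ hv]
    exact mul_le_of_le_one_right (by positivity) (hφ v)
  have hsub : convexHull ℝ (signedTensors q d) ⊆
      {f | inner ℝ (mixedDerivL2 q d φ) f ≤ ((q - 1).factorial : ℝ) ^ d} := by
    refine convexHull_min ?_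
      (convex_halfSpace_le (innerSL ℝ (mixedDerivL2 q d φ)).isLinear _)
    rintro _ (⟨v, hv, rfl⟩ | ⟨v, hv, rfl⟩)
    · exact (le_abs_self _).trans (hb v hv)
    · change inner ℝ _ (-tens q v) ≤ _
      rw [inner_neg_right]
      exact (neg_le_abs _).trans (hb v hv)
  exact closure_minimal hsub
    (isClosed_le (innerSL ℝ (mixedDerivL2 q d φ)).continuous continuous_const) hf

lemma testFunction_eq_zero_of_notMem (φ : 𝓓(openCube d, ℝ)) {u : Fin d → ℝ}
    (hu : u ∉ closedCube d) : φ u = 0 :=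
  image_eq_zero_of_notMem_tsupport fun hc =>
    hu fun k => Ioo_subset_Icc_self (φ.tsupport_subset hc k (mem_univ k))

lemma ofReal_factorial_pow (q d : ℕ) :
    ENNReal.ofReal (((q - 1).factorial : ℝ) ^ d) = ((q - 1).factorial : ℝ≥0∞) ^ d := by
  rw [ENNReal.ofReal_pow (by positivity), ENNReal.ofReal_natCast]

lemma isCompact_absconvTensor {q : ℕ} (hq : 1 ≤ q) (hd : 1 ≤ d) :
    IsCompact (absconvTensor q d) :=
  isCompact_iff_totallyBounded_isComplete.2
    ⟨(hasDyadicCovers_absconvTensor hq hd).totallyBounded hq, isClosed_closure.isComplete⟩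

/-- The support function of the hull bounds the pairing with functions whose pairings with
the derivatives of test functions are bounded. -/
lemma inner_le_of_forall_inner_lt {q : ℕ} (hq : 1 ≤ q) {f g : L2Cube d} {t : ℝ}
    (hf : ∀ φ : 𝓓(openCube d, ℝ), (∀ u, |φ u| ≤ 1) →
      inner ℝ (mixedDerivL2 q d φ) f ≤ ((q - 1).factorial : ℝ) ^ d)
    (hg : g ∈ (nullSpace q d)ᗮ) (hgt : ∀ x ∈ absconvTensor q d, inner ℝ g x < t) :
    inner ℝ g f ≤ t := by
  set R : ℝ := ((q - 1).factorial : ℝ) ^ d with hR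
  have hR0 : 0 < R := by positivity
  have hsub : ∀ x ∈ signedTensors q d, x ∈ absconvTensor q d := fun x hx => by
    rw [absconvTensor_eq]; exact subset_closure (subset_convexHull ℝ _ hx)
  have ht0 : 0 < t := by
    have := hgt 0 (by
      rw [absconvTensor_eq]; exact subset_closure (zero_mem_convexHull_signedTensors q d))
    rwa [inner_zero_right] at this
  refine le_of_forall_pos_le_add fun δ hδ => ?_
  have hf1 : 0 < 1 + ‖f‖ := by positivity
  -- Replacing `g` by `D φ` costs `η` on the tensors, of norm at most `1`, and `η * ‖f‖` at `f`:
  -- together `δ`.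
  set η := δ / (1 + ‖f‖) with hη
  have hη0 : 0 < η := div_pos hδ hf1
  have hgcl : g ∈ closure (LinearMap.range (mixedDerivL2 q d) : Set (L2Cube d)) := by
    rw [nullSpace_eq, Submodule.orthogonal_orthogonal_eq_closure] at hg
    exact hg
  obtain ⟨_, ⟨φ, rfl⟩, hφg⟩ := Metric.mem_closure_iff.1 hgcl η hη0
  rw [dist_eq_norm] at hφg
  have hdiff : ∀ x : L2Cube d, |inner ℝ g x - inner ℝ (mixedDerivL2 q d φ) x| ≤ η * ‖x‖ :=
    fun x => by
      rw [← inner_sub_left]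
      exact (abs_real_inner_le_norm _ _).trans
        (mul_le_mul_of_nonneg_right hφg.le (norm_nonneg _))
  -- Pairing with `±tens q u` gives `R * |φ u| ≤ t + η`, so `s⁻¹ • φ` is an admissible test
  -- function.
  set s := (t + η) / R with hs
  have hs0 : 0 < s := by positivity
  have hφs : ∀ u, |φ u| ≤ s := by
    intro u
    by_cases hu : u ∈ closedCube d
    · rw [hs, le_div_iff₀ hR0, mul_comm, hR, ← abs_inner_mixedDerivL2_tens hq φ hu]
      have h1 := abs_le.1 (hdiff (tens q u))
      have h2 : η * ‖tens q u‖ ≤ η := mul_le_of_le_one_right hη0.le (norm_tens_le_one q hu)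
      have h3 := hgt _ (hsub _ (tens_mem_signedTensors q hu))
      have h4 := hgt _ (hsub _ (neg_tens_mem_signedTensors q hu))
      rw [inner_neg_right] at h4
      rw [abs_le]
      constructor <;> linarith [h1.1, h1.2]
    · rw [testFunction_eq_zero_of_notMem φ hu, abs_zero]
      exact hs0.le
  have h1 := hf (s⁻¹ • φ) fun u => by
    change |s⁻¹ * φ u| ≤ 1
    rw [abs_mul, abs_of_pos (inv_pos.2 hs0), inv_mul_le_iff₀ hs0, mul_one]
    exact hφs u
  rw [map_smul, real_inner_smul_left, inv_mul_le_iff₀ hs0, hs, div_mul_cancel₀ _ hR0.ne'] at h1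
  have h2 := (abs_le.1 (hdiff f)).2
  have h3 : η * (1 + ‖f‖) = δ := div_mul_cancel₀ _ hf1.ne'
  linarith

/-- The projection of the hull of the tensors to the orthogonal complement of the null space is a
ball of the Vitali total variation. -/
theorem image_starProjection_absconvTensor {q : ℕ} (hq : 1 ≤ q) (hd : 1 ≤ d) :
    (nullSpace q d)ᗮ.starProjection '' absconvTensor q d =
      vitaliBall q d (((q - 1).factorial : ℝ≥0∞) ^ d) := by
  have := hasOrthogonalProjection_orthogonal (nullSpace q d)
  have hball : ∀ f : L2Cube d, f ∈ vitaliBall q d (((q - 1).factorial : ℝ≥0∞) ^ d) ↔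
      f ∈ (nullSpace q d)ᗮ ∧ ∀ φ : 𝓓(openCube d, ℝ), (∀ u, |φ u| ≤ 1) →
        inner ℝ (mixedDerivL2 q d φ) f ≤ ((q - 1).factorial : ℝ) ^ d := fun f => by
    rw [← vitaliVariation_le_iff (by positivity), ofReal_factorial_pow]
    rfl
  refine Subset.antisymm ?_ fun f hf => ?_
  · rintro _ ⟨f, hf, rfl⟩
    refine (hball _).2 ⟨Submodule.starProjection_apply_mem _ f, fun φ hφ => ?_⟩
    rw [inner_starProjection_of_mem (mixedDerivL2_mem_orthogonal q φ)]
    exact inner_mixedDerivL2_le hq hφ hf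
  · obtain ⟨hfM, hfR⟩ := (hball f).1 hf
    by_contra hfP
    have hconv : Convex ℝ (absconvTensor q d) := by
      rw [absconvTensor_eq]; exact (convex_convexHull ℝ _).closure
    obtain ⟨g, t, hg, hgt, htf⟩ := exists_separating_of_notMem_image_starProjection
      (isCompact_absconvTensor hq hd) hconv hfM hfP
    exact htf.not_ge (inner_le_of_forall_inner_lt hq hfR hg hgt)

end Duality

end MARS

theorem mainTheorem5 (q d : ℕ) (hq : 1 ≤ q) (hd : 1 ≤ d) :
    -- covering numbers of the truncated power functions
    (2 ≤ q → ∃ C : ℝ, ∀ᶠ ε : ℝ in 𝓝[>] 0,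
      (Metric.coveringNumber ε.toNNReal (MARS.truncPowClass q) : ℝ≥0∞) ≤
        ENNReal.ofReal (C * (1 / ε))) ∧
    (q = 1 → ∃ C : ℝ, ∀ᶠ ε : ℝ in 𝓝[>] 0,
      (Metric.coveringNumber ε.toNNReal (MARS.truncPowClass q) : ℝ≥0∞) ≤
        ENNReal.ofReal (C * (1 / ε) ^ 2)) ∧
    -- entropy of the absolute convex hull of the tensors
    (∃ C : ℝ, ∀ᶠ ε : ℝ in 𝓝[>] 0,
      MARS.entropy ε.toNNReal (MARS.absconvTensor q d) ≤
        ((C * (ε ^ (-(1 / (q : ℝ))) * Real.log (1 / ε) ^ (d - 1) *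
          Real.log (1 / ε) ^ (1 / (2 * (q : ℝ)))) : ℝ) : EReal)) ∧
    -- the orthogonal components of the hull are the ball of the Vitali total variation
    (MARS.nullSpace q d)ᗮ.starProjection '' MARS.absconvTensor q d =
      MARS.vitaliBall q d ((Nat.factorial (q - 1) : ℝ≥0∞) ^ d) ∧
    -- entropy of the class of functions of Vitali total variation at most one
    (∃ C : ℝ, ∀ᶠ ε : ℝ in 𝓝[>] 0,
      MARS.entropy ε.toNNReal (MARS.vitaliBall q d 1) ≤
        ((C * (ε ^ (-(1 / (q : ℝ))) * Real.log (1 / ε) ^ (d - 1) *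
          Real.log (1 / ε) ^ (1 / (2 * (q : ℝ)))) : ℝ) : EReal)) := by
  have hcov := MARS.hasDyadicCovers_absconvTensor hq hd
  have himg := MARS.image_starProjection_absconvTensor hq hd
  refine ⟨MARS.coveringNumber_truncPowClass_of_two_le, ?_, hcov.entropy_le hq, himg, ?_⟩
  · rintro rfl
    exact MARS.coveringNumber_truncPowClass_one
  -- Since `(q - 1)! ≥ 1`, the unit ball of the variation lies in the projected hull, and
  -- projections do not increase distances.
  · refine (hcov.subset_image (MARS.lipschitzWith_starProjection
      (MARS.nullSpace q d)ᗮ) ?_).entropy_le hq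
    rw [himg]
    rintro f ⟨hf, hfr⟩
    refine ⟨hf, hfr.trans (one_le_pow₀ ?_)⟩
    exact_mod_cast Nat.one_le_iff_ne_zero.2 (Nat.factorial_ne_zero (q - 1))
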